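/- The statement is a theorem of synthetic algebraic geometry, that is, of the constructive internal language of a topos with a commutative ring $R$ satisfying the following two axioms. Write $\operatorname{Spec}A=\operatorname{Hom}_{R\text{-Alg}}(A,R)$ for a finitely presented $R$-algebra $A=R[X_1,\dots,X_n]/(f_1,\dots,f_m)$, i.e. the set of common zeros of the $f_i$ in $R^n$. * (Locality) $1\neq 0$ in $R$, and if $a+b$ is invertible, then $a$ is invertible or $b$ is invertible. * (Duality) For every finitely presented $R$-algebra $A$, the homomorphism $A\to(\operatorname{Spec}A\to R)$, $a\mapsto(\varphi\mapsto\varphi(a))$, is an isomorphism. A subset $G\subseteq X$ is *open* if for every $y:X$ the proposition $y\in G$ is merely equivalent to one of the form $r_1\neq0\vee\dots\vee r_k\neq 0$ with $r_i:R$. A *scheme* is a set $X$ for which there merely exists a finite cover by open subsets, each isomorphic to some $\operatorname{Spec}R[X_1,\dots,X_n]/(f_1,\dots,f_m)$. Let $\mathbb D(1)=\{\varepsilon:R\mid\varepsilon^2=0\}$ and $\mathbb D(2)=\{(\varepsilon,\delta):R^2\mid\varepsilon^2=\varepsilon\delta=\delta^2=0\}$. For $x:X$ the *tangent space* is $T_x(X)=\{t:\mathbb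 D(1)\to X\mid t(0)=x\}$. An $R$-module is *finitely copresented* if it is merely isomorphic to the kernel of a linear map $R^n\to R^m$ for some $n,m$. **Lemma.** Let $X$ be a scheme and $x:X$. 1. For all $s,t:T_x(X)$ there is a unique $\psi_{s,t}:\mathbb D(2)\to X$ with $\psi_{s,t}(\varepsilon,0)=s(\varepsilon)$ and $\psi_{s,t}(0,\varepsilon)=t(\varepsilon)$ for all $\varepsilon:\mathbb D(1)$, and $T_x(X)$ is an $R$-module with $(s+t)(\varepsilon)=\psi_{s,t}(\varepsilon,\varepsilon)$ and $(r\cdot t)(\varepsilon)=t(r\varepsilon)$. 2. The $R$-module $T_x(X)$ is finitely copresented. 3. It is the kernel of the Jacobian of the defining polynomials: if $c:\operatorname{Spec}R[X_1,\dots,X_n]/(f_1,\dots,f_m)\to X$ is an isomorphism onto an open subset of $X$ and $c(a)=x$, then there is an $R$-linear isomorphism $e$ from $T_x(X)$ onto the kernel of $\bigl(\tfrac{\partial f_i}{\partial X_j}(a)\bigr)_{i,j}:R^n\to R^m$ such that, for all $t:T_x(X)$ and $\varepsilon:\mathbb D(1)$, the point $a+\varepsilon\, e(t)$ lies in $\operatorname{Spec}R[X_1,\dots,X_n]/(f_1,\dots,f_m)$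 and $t(\varepsilon)=c(a+\varepsilon\, e(t))$. Axioms and conclusion are understood in Kripke–Joyal (sheaf) semantics in the topos of sheaves of sets on an arbitrary site $(\mathcal C,J)$: $R$ is a sheaf of commutative rings on $\mathcal C$, $X$ is a sheaf of sets on $\mathcal C$, $x\in X(U)$ is an element at an arbitrary stage $U\in\mathcal C$; universal quantifiers, implications and maps range over all later stages $W\to U$; "merely exists" and "or" mean existence after restriction to a covering sieve; falsity holds at $W$ if and only if the empty sieve covers $W$. (The site being arbitrary, schemes depending on parameters are included by passing to slice sites.) -/

import Mathlib

/-!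
Synthetic algebraic geometry is carried out in the internal (constructive) language of a topos with
a distinguished commutative ring `R`.  Its axioms are incompatible with the law of excluded
middle, so they are read here by Kripke-Joyal (sheaf) semantics, in the topos of sheaves on an
arbitrary site `(C, J)`:

* a (closed) set is a sheaf `X : Cᵒᵖ ⥤ Type w`, and an element of it in the context
  (at the stage) `U : C` is an element of `X(U)`;
* `∃`, `∨` and "merely" mean: after restriction along the arrows of some covering sieve;
* `⊥` holds at the stage `U` if and only if the empty sieve covers `U`;
* `∀`, `→`, `¬` quantify over all later stages `W ⟶ U`;
* a set in the context `U` is a presheaf on `Over U`; a map `F → G` in the context `U` is a natural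
  transformation between restrictions to `Over U`.

The site is arbitrary, so schemes that depend on a parameter in a context are covered as well: they are
schemes over the slice site.
-/

open CategoryTheory Opposite

universe v u w w'

namespace SynAG

variable {C : Type u} [Category.{v} C]

/-- The restriction homomorphism `R(V) → R(W)` along `g : W ⟶ V`. -/
abbrev res (R : Cᵒᵖ ⥤ CommRingCat.{w}) {V W : C} (g : W ⟶ V) :
    R.obj (op V) →+* R.obj (op W) :=
  (R.map g.op).hom

/-- The restriction of a closed set to the context `V`. -/
abbrev ctx (X : Cᵒᵖ ⥤ Type w) (V : C) : (Over V)ᵒᵖ ⥤ Type w :=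
  (Over.forget V).op ⋙ X

/-! ### Affine schemes -/

/-- The affine scheme `Spec R[X₁,…,Xₙ]/(f₁,…,fₘ)` in the context `V`: its points at `Y ⟶ V` are
the common zeros of the `fᵢ` in `R(Y)ⁿ`. -/
def spec (R : Cᵒᵖ ⥤ CommRingCat.{w}) {V : C} {n m : ℕ}
    (f : Fin m → MvPolynomial (Fin n) (R.obj (op V))) : (Over V)ᵒᵖ ⥤ Type w where
  obj Y := {a : Fin n → R.obj (op Y.unop.left) //
    ∀ i, MvPolynomial.eval₂ (res R Y.unop.hom) a (f i) = 0}
  map {Y Y'} φ := ↾fun a => ⟨fun j => res R φ.unop.left (a.1 j), fun i => by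
    have h := congrArg (res R φ.unop.left) (a.2 i)
    rw [MvPolynomial.eval₂_comp_left, map_zero] at h
    have e : (res R φ.unop.left).comp (res R Y.unop.hom) = res R Y'.unop.hom := by
      rw [← Over.w φ.unop]
      simp [res, ← CommRingCat.hom_comp, ← R.map_comp, ← op_comp]
    rw [e] at h
    exact h⟩
  map_id Y := by ext a; simp [res]
  map_comp f g := by ext a; simp [res]

/-! ### The axioms on the base ring -/

/-- The ring `R` is local: `1 ≠ 0`, and if `a + b` is invertible, then `a` is invertible or `b` is
invertible. -/
def Locality (J : GrothendieckTopology C) (R : Cᵒᵖ ⥤ CommRingCat.{w}) : Prop :=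
  (∀ V : C, (1 : R.obj (op V)) = 0 → (⊥ : Sieve V) ∈ J V) ∧
  ∀ (V : C) (a b : R.obj (op V)), IsUnit (a + b) →
    ∃ S ∈ J V, ∀ ⦃W : C⦄ (g : W ⟶ V), S g → IsUnit (res R g a) ∨ IsUnit (res R g b)

/-- Duality: for every finitely presented `R`-algebra `A = R[X₁,…,Xₙ]/(f₁,…,fₘ)`, the homomorphism
`A → (Spec A → R)`, `a ↦ (φ ↦ φ(a))`, is injective and surjective. -/
def Duality (J : GrothendieckTopology C) (R : Cᵒᵖ ⥤ CommRingCat.{w}) : Prop :=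
  ∀ (V : C) (n m : ℕ) (f : Fin m → MvPolynomial (Fin n) (R.obj (op V))),
    (∀ p : MvPolynomial (Fin n) (R.obj (op V)),
      (∀ (Y : Over V) (a : (spec R f).obj (op Y)),
        MvPolynomial.eval₂ (res R Y.hom) a.1 p = 0) →
      ∃ S ∈ J V, ∀ ⦃W : C⦄ (g : W ⟶ V), S g →
        MvPolynomial.map (res R g) p ∈
          Ideal.span (Set.range fun i => MvPolynomial.map (res R g) (f i))) ∧
    (∀ φ : spec R f ⟶ ctx (R ⋙ forget CommRingCat) V,
      ∃ S ∈ J V, ∀ ⦃W : C⦄ (g : W ⟶ V), S g →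
        ∃ p : MvPolynomial (Fin n) (R.obj (op W)),
          ∀ (Y : Over W) (a : (spec R f).obj (op ((Over.map g).obj Y))),
            φ.app (op ((Over.map g).obj Y)) a = MvPolynomial.eval₂ (res R Y.hom) a.1 p)

/-! ### Open subsets and schemes -/

/-- At the stage `V` it holds that `r ≠ 0`. -/
def NeZeroAt (J : GrothendieckTopology C) (R : Cᵒᵖ ⥤ CommRingCat.{w}) {V : C}
    (r : R.obj (op V)) : Prop :=
  ∀ ⦃W : C⦄ (g : W ⟶ V), res R g r = 0 → (⊥ : Sieve W) ∈ J W

/-- At the stage `V` it holds that `r₁ ≠ 0 ∨ … ∨ rₖ ≠ 0`. -/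
def SomeNeZeroAt (J : GrothendieckTopology C) (R : Cᵒᵖ ⥤ CommRingCat.{w}) {V : C} {k : ℕ}
    (r : Fin k → R.obj (op V)) : Prop :=
  ∃ S ∈ J V, ∀ ⦃W : C⦄ (g : W ⟶ V), S g → ∃ i, NeZeroAt J R (res R g (r i))

/-- A subset `G` of `X` in the context `V` is open: for all `y : X`, the proposition `y ∈ G` is
merely equivalent to one of the form `r₁ ≠ 0 ∨ … ∨ rₖ ≠ 0`. -/
def IsOpenSubset (J : GrothendieckTopology C) (R : Cᵒᵖ ⥤ CommRingCat.{w}) {X : Cᵒᵖ ⥤ Type w}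
    {V : C} (G : Subfunctor (ctx X V)) : Prop :=
  ∀ (Y : Over V) (y : X.obj (op Y.left)),
    ∃ S ∈ J Y.left, ∀ ⦃W : C⦄ (g : W ⟶ Y.left), S g →
      ∃ (k : ℕ) (r : Fin k → R.obj (op W)), ∀ ⦃W' : C⦄ (h : W' ⟶ W),
        X.map (h ≫ g).op y ∈ G.obj (op (Over.mk ((h ≫ g) ≫ Y.hom))) ↔
          SomeNeZeroAt J R fun i => res R h (r i)

/-- An affine open chart of `X` in the context `V`: an isomorphism from
`Spec R[X₁,…,Xₙ]/(f₁,…,fₘ)` onto an open subset of `X`. -/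
def IsAffineOpenChart (J : GrothendieckTopology C) (R : Cᵒᵖ ⥤ CommRingCat.{w})
    {X : Cᵒᵖ ⥤ Type w} {V : C} {n m : ℕ}
    {f : Fin m → MvPolynomial (Fin n) (R.obj (op V))} (c : spec R f ⟶ ctx X V) : Prop :=
  (∀ Y : (Over V)ᵒᵖ, Function.Injective (c.app Y)) ∧ IsOpenSubset J R (Subfunctor.range c)

/-- `X` is a scheme: there merely exists a finite cover of `X` by affine open subsets. -/
def IsScheme (J : GrothendieckTopology C) (R : Cᵒᵖ ⥤ CommRingCat.{w})
    (X : Cᵒᵖ ⥤ Type w) : Prop :=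
  ∀ V : C, ∃ S ∈ J V, ∀ ⦃W : C⦄ (g : W ⟶ V), S g →
    ∃ (k : ℕ) (n m : Fin k → ℕ)
      (f : ∀ i, Fin (m i) → MvPolynomial (Fin (n i)) (R.obj (op W)))
      (c : ∀ i, spec R (f i) ⟶ ctx X W),
      (∀ i, IsAffineOpenChart J R (c i)) ∧
      ∀ (Y : Over W) (y : X.obj (op Y.left)),
        ∃ T ∈ J Y.left, ∀ ⦃W' : C⦄ (h : W' ⟶ Y.left), T h →
          ∃ i, X.map h.op y ∈ (Subfunctor.range (c i)).obj (op (Over.mk (h ≫ Y.hom)))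

/-! ### Infinitesimal disks and tangent spaces -/

/-- The disk `𝔻(1) = {ε : R | ε² = 0}`. -/
def D1 (R : Cᵒᵖ ⥤ CommRingCat.{w}) : Cᵒᵖ ⥤ Type w where
  obj V := {ε : R.obj V // ε ^ 2 = 0}
  map φ := ↾fun ε => ⟨(R.map φ).hom ε.1, by rw [← map_pow, ε.2, map_zero]⟩
  map_id V := by ext ε; simp
  map_comp f g := by ext ε; simp

/-- The disk `𝔻(2) = {(ε, δ) : R² | ε² = εδ = δ² = 0}`. -/
def D2 (R : Cᵒᵖ ⥤ CommRingCat.{w}) : Cᵒᵖ ⥤ Type w where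
  obj V := {p : R.obj V × R.obj V // p.1 ^ 2 = 0 ∧ p.1 * p.2 = 0 ∧ p.2 ^ 2 = 0}
  map φ := ↾fun p => ⟨((R.map φ).hom p.1.1, (R.map φ).hom p.1.2), by
    simp only [← map_pow, ← map_mul, p.2.1, p.2.2.1, p.2.2.2, map_zero, and_self]⟩
  map_id V := by
    refine ConcreteCategory.hom_ext _ _ fun p => Subtype.ext ?_
    change ((R.map (𝟙 V)).hom p.1.1, (R.map (𝟙 V)).hom p.1.2) = p.1
    simp
  map_comp f g := by
    refine ConcreteCategory.hom_ext _ _ fun p => Subtype.ext ?_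
    change ((R.map (f ≫ g)).hom p.1.1, (R.map (f ≫ g)).hom p.1.2) =
      ((R.map g).hom ((R.map f).hom p.1.1), (R.map g).hom ((R.map f).hom p.1.2))
    simp

/-- The map `ε ↦ (ε, 0)`. -/
def inl (R : Cᵒᵖ ⥤ CommRingCat.{w}) : D1 R ⟶ D2 R where
  app V := ↾fun ε => ⟨(ε.1, 0), ε.2, mul_zero _, zero_pow two_ne_zero⟩
  naturality V W φ := by
    ext ε
    apply Subtype.ext
    change ((R.map φ).hom ε.1, (0 : R.obj W)) = ((R.map φ).hom ε.1, (R.map φ).hom 0)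
    rw [map_zero]

/-- The map `ε ↦ (0, ε)`. -/
def inr (R : Cᵒᵖ ⥤ CommRingCat.{w}) : D1 R ⟶ D2 R where
  app V := ↾fun ε => ⟨(0, ε.1), zero_pow two_ne_zero, zero_mul _, ε.2⟩
  naturality V W φ := by
    ext ε
    apply Subtype.ext
    change ((0 : R.obj W), (R.map φ).hom ε.1) = ((R.map φ).hom 0, (R.map φ).hom ε.1)
    rw [map_zero]

/-- The map `ε ↦ (ε, ε)`. -/
def diag (R : Cᵒᵖ ⥤ CommRingCat.{w}) : D1 R ⟶ D2 R where
  app V := ↾fun ε => ⟨(ε.1, ε.1), ε.2, by rw [← pow_two]; exact ε.2, ε.2⟩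
  naturality V W φ := rfl

/-- The map `ε ↦ rε` in the context `V`, for `r : R`. -/
def scale (R : Cᵒᵖ ⥤ CommRingCat.{w}) {V : C} (r : R.obj (op V)) :
    ctx (D1 R) V ⟶ ctx (D1 R) V where
  app Y := ↾fun (ε : {ε : R.obj (op Y.unop.left) // ε ^ 2 = 0}) =>
    (⟨res R Y.unop.hom r * ε.1, by rw [mul_pow, ε.2, mul_zero]⟩ :
      {ε : R.obj (op Y.unop.left) // ε ^ 2 = 0})
  naturality Y Y' φ := by
    ext (ε : {ε : R.obj (op Y.unop.left) // ε ^ 2 = 0})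
    have e : res R Y'.unop.hom r = res R φ.unop.left (res R Y.unop.hom r) := by
      rw [← Over.w φ.unop, res, op_comp, R.map_comp]
      rfl
    apply Subtype.ext
    change res R Y'.unop.hom r * res R φ.unop.left ε.1 =
      res R φ.unop.left (res R Y.unop.hom r * ε.1)
    rw [map_mul, e]

/-- The point `0` of `𝔻(1)`. -/
def zeroD1 (R : Cᵒᵖ ⥤ CommRingCat.{w}) (V : Cᵒᵖ) : (D1 R).obj V :=
  ⟨0, zero_pow two_ne_zero⟩

/-- The tangent space `T_x(X) = {t : 𝔻(1) → X | t(0) = x}` for `x : X` in the context `U`, as a set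
in the context `U`.  Its elements at `Y ⟶ U` are the maps `𝔻(1) → X` in the context `Y` that send
`0` to the restriction of `x`; restriction is that of the exponential `presheafHom`. -/
def tangentSpace (R : Cᵒᵖ ⥤ CommRingCat.{w}) (X : Cᵒᵖ ⥤ Type w) {U : C} (x : X.obj (op U)) :
    (Over U)ᵒᵖ ⥤ Type (max u v w) where
  obj Y := {t : ctx (D1 R) Y.unop.left ⟶ ctx X Y.unop.left //
    t.app (op (Over.mk (𝟙 Y.unop.left))) (zeroD1 R (op Y.unop.left)) = X.map Y.unop.hom.op x}
  map {Y Y'} φ := ↾fun t => ⟨(presheafHom (D1 R) X).map φ.unop.left.op t.1, by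
    have h := t.1.naturality (Over.homMk φ.unop.left :
      Over.mk φ.unop.left ⟶ Over.mk (𝟙 Y.unop.left)).op
    have h1 : t.1.app (op (Over.mk φ.unop.left))
          ((D1 R).map φ.unop.left.op (zeroD1 R (op Y.unop.left))) =
        X.map φ.unop.left.op
          (t.1.app (op (Over.mk (𝟙 Y.unop.left))) (zeroD1 R (op Y.unop.left))) :=
      ConcreteCategory.congr_hom h (zeroD1 R (op Y.unop.left))
    have hz : (D1 R).map φ.unop.left.op (zeroD1 R (op Y.unop.left)) =
        zeroD1 R (op Y'.unop.left) :=
      Subtype.ext (map_zero (res R φ.unop.left))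
    have h2 := congrArg (fun s => s (zeroD1 R (op Y'.unop.left)))
      (congrArg (fun s => (ConcreteCategory.hom s : _ → _))
        (presheafHom_map_app_op_mk_id φ.unop.left t.1))
    refine h2.trans ?_
    rw [hz, t.2] at h1
    refine h1.trans ?_
    rw [← Over.w φ.unop, op_comp, X.map_comp]
    rfl⟩
  map_id Y := by
    refine ConcreteCategory.hom_ext _ _ fun t => Subtype.ext ?_
    exact ConcreteCategory.congr_hom ((presheafHom (D1 R) X).map_id (op Y.unop.left)) t.1
  map_comp f g := by
    refine ConcreteCategory.hom_ext _ _ fun t => Subtype.ext ?_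
    exact ConcreteCategory.congr_hom
      ((presheafHom (D1 R) X).map_comp f.unop.left.op g.unop.left.op) t.1

/-! ### Modules in a context -/

/-- `F` is an `R`-module in the context `U`: restriction maps are additive and semilinear. -/
def IsModuleInContext (R : Cᵒᵖ ⥤ CommRingCat.{w}) {U : C} (F : (Over U)ᵒᵖ ⥤ Type w')
    [∀ Y, AddCommGroup (F.obj Y)] [∀ Y : (Over U)ᵒᵖ, Module (R.obj (op Y.unop.left)) (F.obj Y)] :
    Prop :=
  ∀ ⦃Y Y' : (Over U)ᵒᵖ⦄ (φ : Y ⟶ Y'),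
    (∀ s t : F.obj Y, F.map φ (s + t) = F.map φ s + F.map φ t) ∧
    ∀ (r : R.obj (op Y.unop.left)) (t : F.obj Y),
      F.map φ (r • t) = res R φ.unop.left r • F.map φ t

/-- An `R`-module `F` in the context `U` is finitely copresented: it is merely the kernel of a
linear map `Rⁿ → Rᵐ`, that is, after restriction to the members `W` of a cover of `U`, it is
isomorphic as an `R`-module to the kernel of an `m × n`-matrix with entries in `R(W)`. -/
def IsFinitelyCopresented (J : GrothendieckTopology C) (R : Cᵒᵖ ⥤ CommRingCat.{w}) {U : C}
    (F : (Over U)ᵒᵖ ⥤ Type w') [∀ Y, AddCommGroup (F.obj Y)]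
    [∀ Y : (Over U)ᵒᵖ, Module (R.obj (op Y.unop.left)) (F.obj Y)] : Prop :=
  ∃ S ∈ J U, ∀ W : Over U, S W.hom →
    ∃ (n m : ℕ) (A : Matrix (Fin m) (Fin n) (R.obj (op W.left)))
      (e : ∀ (Y : (Over U)ᵒᵖ) (h : Y.unop ⟶ W), F.obj Y ≃ₗ[R.obj (op Y.unop.left)]
        LinearMap.ker (A.map (res R h.left)).mulVecLin),
      ∀ ⦃Y Y' : (Over U)ᵒᵖ⦄ (φ : Y ⟶ Y') (h : Y.unop ⟶ W) (t : F.obj Y) (j : Fin n),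
        (e Y' (φ.unop ≫ h) (F.map φ t)).1 j = res R φ.unop.left ((e Y h t).1 j)

/-- The Jacobian matrix `(∂fᵢ/∂Xⱼ)(a)`. -/
noncomputable def jacobianAt {A : Type w} [CommRing A] {n m : ℕ}
    (f : Fin m → MvPolynomial (Fin n) A) (a : Fin n → A) : Matrix (Fin m) (Fin n) A :=
  Matrix.of fun i j => MvPolynomial.eval a (MvPolynomial.pderiv j (f i))

/-- `ψ : 𝔻(2) → X` satisfies `ψ(ε, 0) = s(ε)` and `ψ(0, ε) = t(ε)` for all `ε : 𝔻(1)`. -/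
def Extends {R : Cᵒᵖ ⥤ CommRingCat.{w}} {X : Cᵒᵖ ⥤ Type w} {V : C}
    (ψ : ctx (D2 R) V ⟶ ctx X V) (s t : ctx (D1 R) V ⟶ ctx X V) : Prop :=
  Functor.whiskerLeft (Over.forget V).op (inl R) ≫ ψ = s ∧
    Functor.whiskerLeft (Over.forget V).op (inr R) ≫ ψ = t

end SynAG

/-! Two consequences of the axioms carry the proof. The first concerns open subsets. If `r₁,…,rₖ` do
not all vanish, then the spectrum of `R/(r₁,…,rₖ)` is empty, so injectivity in duality gives `1 ∈
(r₁,…,rₖ)`, and by locality some `rᵢ` is invertible, in particular nonzero. So the propositions that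
define open subsets are stable under double negation. Elements with `εᵢεⱼ = 0` generate an ideal of
square zero, so by the same argument they are not not zero. Hence a map from a disk `𝔻(k)` that
sends `0` into an open subset stays inside it (`IsOpenSubset.locally_mem`).

The second is the Kock-Lawvere property: duality for `R[X₁,…,Xₖ]/(XᵢXⱼ)`, which is `R ⊕ Rᵏ`, says
that every function on `𝔻(k)` is affine with unique coefficients (`exists_affine_of_disk`,
`eq_zero_of_disk`).

Together they show that a map from `𝔻(k)` through a chart point `c(a)` has the form `ε ↦ c(a + ∑
εₗvₗ)`. By Taylor expansion the equations of the chart take the values `∑ εₗ(Jvₗ)ᵢ` there, with `J`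
the Jacobian at `a`; these vanish for all `ε` exactly when every `Jvₗ` is zero
(`exists_affine_in_chart`). For `k = 1` this identifies tangent vectors with `ker J`. For `k = 2` it
shows that a map on `𝔻(2)` is determined by its two axes, that any two tangent vectors extend to it,
and that its diagonal has direction `v + w`, so the identification is linear.

Charts through `x` exist only on a cover. Since extensions to `𝔻(2)` are unique, they glue. The
module laws are equalities of maps into a sheaf, so they may be checked in charts, where they are
laws of `Rⁿ`. -/

namespace SynAG

variable {C : Type u} [Category.{v} C]

/-! ### Local truth -/

/-- The property `P` of the arrows into `V` holds on a covering sieve. -/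
def Locally (J : GrothendieckTopology C) {V : C} (P : ∀ ⦃W : C⦄, (W ⟶ V) → Prop) : Prop :=
  ∃ S ∈ J V, ∀ ⦃W : C⦄ (g : W ⟶ V), S g → P g

section Locally

variable {J : GrothendieckTopology C} {V : C}

theorem Locally.of_forall {P : ∀ ⦃W : C⦄, (W ⟶ V) → Prop} (h : ∀ ⦃W : C⦄ (g : W ⟶ V), P g) :
    Locally J P :=
  ⟨⊤, J.top_mem V, fun _ g _ => h g⟩

theorem Locally.of_bot (h : (⊥ : Sieve V) ∈ J V) (P : ∀ ⦃W : C⦄, (W ⟶ V) → Prop) :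
    Locally J P :=
  ⟨⊥, h, fun _ _ hg => hg.elim⟩

theorem Locally.mono {P Q : ∀ ⦃W : C⦄, (W ⟶ V) → Prop} (hP : Locally J P)
    (h : ∀ ⦃W : C⦄ (g : W ⟶ V), P g → Q g) : Locally J Q :=
  let ⟨S, hS, hg⟩ := hP
  ⟨S, hS, fun _ g hgS => h g (hg g hgS)⟩

theorem Locally.bind {P Q : ∀ ⦃W : C⦄, (W ⟶ V) → Prop} (hP : Locally J P)
    (h : ∀ ⦃W : C⦄ (g : W ⟶ V), P g → Locally J fun _ k => Q (k ≫ g)) : Locally J Q := by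
  obtain ⟨S, hS, hg⟩ := hP
  choose T hT hQ using fun W (g : W ⟶ V) (hgS : S g) => h g (hg g hgS)
  refine ⟨Sieve.bind S fun W g hgS => T W g hgS, J.bind_covering hS fun W g hgS => hT W g hgS, ?_⟩
  rintro W _ ⟨Z, k, g, hgS, hk, rfl⟩
  exact hQ Z g hgS k hk

theorem Locally.pullback {P : ∀ ⦃W : C⦄, (W ⟶ V) → Prop} (hP : Locally J P) {Z : C}
    (k : Z ⟶ V) : Locally J fun _ g => P (g ≫ k) :=
  let ⟨S, hS, hg⟩ := hP
  ⟨S.pullback k, J.pullback_stable k hS, fun _ g hgS => hg (g ≫ k) hgS⟩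

theorem Locally.bot_mem
    (h : Locally J fun W (_ : W ⟶ V) => (⊥ : Sieve W) ∈ J W) : (⊥ : Sieve V) ∈ J V := by
  obtain ⟨S, hS, hg⟩ := h
  refine J.transitive hS _ fun W g hgS => ?_
  rw [Sieve.pullback_bot]
  exact hg g hgS

end Locally

/-! ### Restriction and gluing -/

section Restriction

variable {J : GrothendieckTopology C} {R : Cᵒᵖ ⥤ CommRingCat.{w}} {X : Cᵒᵖ ⥤ Type w}

theorem res_id {V : C} (r : R.obj (op V)) : res R (𝟙 V) r = r := by simp [res]

theorem res_comp {V W Z : C} (h : Z ⟶ W) (g : W ⟶ V) (r : R.obj (op V)) :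
    res R (h ≫ g) r = res R h (res R g r) := by simp [res]

theorem res_comp' {V W Z : C} (h : Z ⟶ W) (g : W ⟶ V) :
    res R (h ≫ g) = (res R h).comp (res R g) := RingHom.ext (res_comp h g)

theorem map_id' {V : C} (y : X.obj (op V)) : X.map (𝟙 V).op y = y := by simp

theorem map_comp' {V W Z : C} (h : Z ⟶ W) (g : W ⟶ V) (y : X.obj (op V)) :
    X.map (h ≫ g).op y = X.map h.op (X.map g.op y) := by simp

theorem eq_of_locally (hX : Presieve.IsSheaf J X) {V : C} {y z : X.obj (op V)}
    (h : Locally J fun _ (g : _ ⟶ V) => X.map g.op y = X.map g.op z) : y = z := by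
  obtain ⟨S, hS, hg⟩ := h
  exact (hX S hS).isSeparatedFor.ext fun W g hgS => hg g hgS

theorem res_eq_of_locally (hR : Presieve.IsSheaf J (R ⋙ forget CommRingCat)) {V : C}
    {r s : R.obj (op V)} (h : Locally J fun _ (g : _ ⟶ V) => res R g r = res R g s) : r = s :=
  eq_of_locally (X := R ⋙ forget CommRingCat) hR h

theorem eq_of_bot_mem (hR : Presieve.IsSheaf J (R ⋙ forget CommRingCat)) {V : C}
    (h : (⊥ : Sieve V) ∈ J V) (r s : R.obj (op V)) : r = s :=
  res_eq_of_locally hR (.of_bot h _)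

/-- Elements that exist and are unique locally exist. -/
theorem exists_glue {X : Cᵒᵖ ⥤ Type w'} (hX : Presieve.IsSheaf J X) {V : C}
    {P : ∀ ⦃W : C⦄ (_ : W ⟶ V), X.obj (op W) → Prop}
    (hP : ∀ ⦃W Z : C⦄ (g : W ⟶ V) (k : Z ⟶ W) (y : X.obj (op W)),
      P g y → P (k ≫ g) (X.map k.op y))
    (hunique : ∀ ⦃W : C⦄ (g : W ⟶ V) (y z : X.obj (op W)), P g y → P g z → y = z)
    (h : Locally J fun _ (g : _ ⟶ V) => ∃ y, P g y) :
    ∃ y : X.obj (op V), Locally J fun _ g => P g (X.map g.op y) := by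
  obtain ⟨S, hS, hg⟩ := h
  choose y hy using hg
  have hc : Presieve.FamilyOfElements.Compatible (P := X) (R := S.arrows) y := by
    intro Y₁ Y₂ Z g₁ g₂ f₁ f₂ h₁ h₂ e
    -- Both restrictions to the overlap satisfy `P`, so uniqueness makes the chosen family
    -- compatible.
    refine hunique (g₁ ≫ f₁) _ _ (hP _ _ _ (hy f₁ h₁)) ?_
    rw [e]
    exact hP _ _ _ (hy f₂ h₂)
  refine ⟨(hX S hS).amalgamate y hc, S, hS, fun W g hgS => ?_⟩
  exact (congrArg (P g) ((hX S hS).valid_glue hc g hgS)).mpr (hy g hgS)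

/-- Vectors over `R` that exist and are unique locally exist. -/
theorem exists_glue_vector (hR : Presieve.IsSheaf J (R ⋙ forget CommRingCat)) {V : C} {k : ℕ}
    {P : ∀ ⦃W : C⦄ (_ : W ⟶ V), (Fin k → R.obj (op W)) → Prop}
    (hP : ∀ ⦃W Z : C⦄ (g : W ⟶ V) (h : Z ⟶ W) (b : Fin k → R.obj (op W)),
      P g b → P (h ≫ g) fun i => res R h (b i))
    (hunique : ∀ ⦃W : C⦄ (g : W ⟶ V) (b b' : Fin k → R.obj (op W)), P g b → P g b' → b = b')
    (h : Locally J fun _ (g : _ ⟶ V) => ∃ b, P g b) :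
    ∃ b : Fin k → R.obj (op V), Locally J fun _ g => P g fun i => res R g (b i) := by
  obtain ⟨S, hS, hg⟩ := h
  choose y hy using hg
  have hc : ∀ i, Presieve.FamilyOfElements.Compatible (P := R ⋙ forget CommRingCat)
      (R := S.arrows) fun W g hg => y g hg i := by
    intro i Y₁ Y₂ Z g₁ g₂ f₁ f₂ h₁ h₂ e
    refine congrFun (hunique (g₁ ≫ f₁) _ (fun i => res R g₂ (y f₂ h₂ i))
      (hP _ _ _ (hy f₁ h₁)) ?_) i
    rw [e]
    exact hP _ _ _ (hy f₂ h₂)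
  refine ⟨fun i => (hR S hS).amalgamate _ (hc i), S, hS, fun W g hgS => ?_⟩
  have e : (fun i => res R g ((hR S hS).amalgamate _ (hc i))) = y g hgS :=
    funext fun i => (hR S hS).valid_glue (hc i) g hgS
  exact (congrArg (P g) e).mpr (hy g hgS)

theorem eval₂_res_comp {n : ℕ} {V W Z : C} (h : Z ⟶ W) (g : W ⟶ V) (a : Fin n → R.obj (op W))
    (p : MvPolynomial (Fin n) (R.obj (op V))) :
    MvPolynomial.eval₂ (res R (h ≫ g)) (fun j => res R h (a j)) p =
      res R h (MvPolynomial.eval₂ (res R g) a p) := by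
  rw [MvPolynomial.eval₂_comp_left, res_comp']
  rfl

end Restriction

/-! ### Consequences of duality and locality -/

section Axioms

variable {J : GrothendieckTopology C} {R : Cᵒᵖ ⥤ CommRingCat.{w}}

/-- A Nullstellensatz: the hypothesis says that the spectrum of `R/(r₁,…,rₖ)` is empty, so the
function `1` on it equals `0`, and injectivity in duality applies. -/
theorem locally_one_mem_span (hR : Presieve.IsSheaf J (R ⋙ forget CommRingCat))
    (hduality : Duality J R) {V : C} {k : ℕ} (r : Fin k → R.obj (op V))
    (h : ∀ ⦃W : C⦄ (g : W ⟶ V), (∀ i, res R g (r i) = 0) → (⊥ : Sieve W) ∈ J W) :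
    Locally J fun _ (g : _ ⟶ V) => 1 ∈ Ideal.span (Set.range fun i => res R g (r i)) := by
  -- The quotient of `R` is presented with no variables and constant relations. A stage that has a
  -- point of its spectrum is covered by the empty sieve, so all elements of `R` are equal there.
  have key := (hduality V 0 k fun i => MvPolynomial.C (r i)).1 1 fun Y a =>
    eq_of_bot_mem hR (h Y.hom fun i => by simpa using a.2 i) _ _
  refine Locally.mono key fun W g hg => ?_
  have h1 := Ideal.mem_map_of_mem (MvPolynomial.eval (fun i : Fin 0 => (0 : R.obj (op W)))) hg
  rw [Ideal.map_span, ← Set.range_comp] at h1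
  simpa [Function.comp_def] using h1

theorem locally_isUnit_of_sum (hlocal : Locality J R) {ι : Type*} (s : Finset ι) :
    ∀ {V : C} (r : ι → R.obj (op V)), IsUnit (∑ i ∈ s, r i) →
      Locally J fun _ (g : _ ⟶ V) => ∃ i ∈ s, IsUnit (res R g (r i)) := by
  classical
  induction s using Finset.induction_on with
  | empty =>
    intro V r hr
    refine .of_bot (hlocal.1 V ?_) _
    rw [Finset.sum_empty, isUnit_zero_iff] at hr
    exact hr.symm
  | insert a s ha ih =>
    intro V r hr
    rw [Finset.sum_insert ha] at hr
    refine Locally.bind (hlocal.2 V _ _ hr) fun W g hg => ?_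
    rcases hg with hg | hg
    · refine .of_forall fun Z k => ⟨a, Finset.mem_insert_self a s, ?_⟩
      rw [res_comp]
      exact hg.map _
    · rw [map_sum] at hg
      refine (ih _ hg).mono fun Z k => ?_
      rintro ⟨i, hi, hu⟩
      exact ⟨i, Finset.mem_insert_of_mem hi, by rwa [res_comp]⟩

theorem neZeroAt_of_isUnit (hlocal : Locality J R) {V : C} {r : R.obj (op V)} (hr : IsUnit r) :
    NeZeroAt J R r := by
  intro W g h
  refine hlocal.1 W ?_
  have := hr.map (res R g)
  rw [h, isUnit_zero_iff] at this
  exact this.symm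

/-- If not all `rᵢ` vanish, then some `rᵢ` does not vanish. -/
theorem someNeZeroAt_of_forall (hR : Presieve.IsSheaf J (R ⋙ forget CommRingCat))
    (hlocal : Locality J R) (hduality : Duality J R) {V : C} {k : ℕ} (r : Fin k → R.obj (op V))
    (h : ∀ ⦃W : C⦄ (g : W ⟶ V), (∀ i, res R g (r i) = 0) → (⊥ : Sieve W) ∈ J W) :
    SomeNeZeroAt J R r := by
  refine Locally.bind (locally_one_mem_span hR hduality r h) fun W g hg => ?_
  rw [Ideal.span, Submodule.mem_span_range_iff_exists_fun] at hg
  obtain ⟨c, hc⟩ := hg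
  refine (locally_isUnit_of_sum hlocal Finset.univ _ (hc ▸ isUnit_one)).mono fun Z l => ?_
  rintro ⟨i, -, hi⟩
  rw [smul_eq_mul, map_mul, ← res_comp] at hi
  exact ⟨i, neZeroAt_of_isUnit hlocal (isUnit_of_mul_isUnit_right hi)⟩

/-- Elements with vanishing products are not not zero. -/
theorem bot_mem_of_mul_eq_zero (hR : Presieve.IsSheaf J (R ⋙ forget CommRingCat))
    (hlocal : Locality J R) (hduality : Duality J R) {V : C} {k : ℕ} (ε : Fin k → R.obj (op V))
    (hε : ∀ i j, ε i * ε j = 0)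
    (h : ∀ ⦃W : C⦄ (g : W ⟶ V), (∀ i, res R g (ε i) = 0) → (⊥ : Sieve W) ∈ J W) :
    (⊥ : Sieve V) ∈ J V := by
  refine Locally.bot_mem ((locally_one_mem_span hR hduality ε h).mono fun W g hg => ?_)
  refine hlocal.1 W ?_
  rw [Ideal.span, Submodule.mem_span_range_iff_exists_fun] at hg
  obtain ⟨c, hc⟩ := hg
  have hε' : ∀ i j, res R g (ε i) * res R g (ε j) = 0 := fun i j => by
    rw [← map_mul, hε, map_zero]
  -- With `1 = ∑ cᵢεᵢ`, the product `1 · 1` is a combination of the `εᵢεⱼ`, hence zero.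
  rw [← one_mul (1 : R.obj (op W)), ← hc, Finset.sum_mul_sum]
  refine Finset.sum_eq_zero fun i _ => Finset.sum_eq_zero fun j _ => ?_
  rw [smul_eq_mul, smul_eq_mul, mul_mul_mul_comm, hε', mul_zero]

/-- An open subset contains every infinitesimal neighbour of its points. -/
theorem IsOpenSubset.locally_mem (hR : Presieve.IsSheaf J (R ⋙ forget CommRingCat))
    (hlocal : Locality J R) (hduality : Duality J R) {X : Cᵒᵖ ⥤ Type w} {V : C}
    {G : Subfunctor (ctx X V)} (hG : IsOpenSubset J R G) {W : C} (k : W ⟶ V)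
    (y : X.obj (op W)) {p : ℕ} (ε : Fin p → R.obj (op W)) (hε : ∀ i j, ε i * ε j = 0)
    (hy : ∀ ⦃Z : C⦄ (g : Z ⟶ W), (∀ i, res R g (ε i) = 0) →
      X.map g.op y ∈ G.obj (op (Over.mk (g ≫ k)))) :
    Locally J fun _ (g : _ ⟶ W) => X.map g.op y ∈ G.obj (op (Over.mk (g ≫ k))) := by
  refine Locally.mono (hG (Over.mk k) y) fun W' g hg => ?_
  obtain ⟨q, r, hr⟩ := hg
  -- Where all `rᵢ` vanish, `y` is not in `G`, so the `εᵢ` cannot all vanish; but they are not not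
  -- zero.
  have key : SomeNeZeroAt J R r := by
    refine someNeZeroAt_of_forall hR hlocal hduality r fun Z h hz => ?_
    refine bot_mem_of_mul_eq_zero hR hlocal hduality (fun i => res R (h ≫ g) (ε i))
      (fun i j => by rw [← map_mul, hε, map_zero]) fun Z' l hl => ?_
    have h1 := (hr (l ≫ h)).1 (by
      have := hy ((l ≫ h) ≫ g) fun i => by
        rw [Category.assoc, res_comp]
        exact hl i
      exact this)
    refine Locally.bot_mem (Locally.mono h1 fun Z'' m hm => ?_)
    obtain ⟨i, hi⟩ := hm
    refine Locally.bot_mem (.of_forall fun Z₃ m' => hi m' ?_)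
    simp only [res_comp, hz, map_zero]
  have h2 := (hr (𝟙 W')).2 (by simpa only [res_id] using key)
  rw [Category.id_comp] at h2
  exact h2

end Axioms

/-! ### First-order Taylor expansion -/

theorem eval₂_add_of_mul_eq_zero {A B : Type*} [CommRing A] [CommRing B] {n : ℕ} (φ : A →+* B)
    (a h : Fin n → B) (hh : ∀ i j, h i * h j = 0) (p : MvPolynomial (Fin n) A) :
    MvPolynomial.eval₂ φ (fun j => a j + h j) p = MvPolynomial.eval₂ φ a p +
      ∑ j, MvPolynomial.eval₂ φ a (MvPolynomial.pderiv j p) * h j := by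
  induction p using MvPolynomial.induction_on with
  | C r => simp
  | add p q hp hq =>
    simp only [MvPolynomial.eval₂_add, map_add, hp, hq, add_mul, Finset.sum_add_distrib]
    ring
  | mul_X p i hp =>
    -- The only second-order term that arises on multiplication by `X i`.
    have h0 : (∑ j, MvPolynomial.eval₂ φ a (MvPolynomial.pderiv j p) * h j) * h i = 0 := by
      rw [Finset.sum_mul]
      exact Finset.sum_eq_zero fun j _ => by rw [mul_assoc, hh, mul_zero]
    have h1 : ∑ j, MvPolynomial.eval₂ φ a (MvPolynomial.pderiv j (p * MvPolynomial.X i)) * h j =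
        (∑ j, MvPolynomial.eval₂ φ a (MvPolynomial.pderiv j p) * h j) * a i +
          MvPolynomial.eval₂ φ a p * h i := by
      have : ∀ j, MvPolynomial.eval₂ φ a (MvPolynomial.pderiv j (p * MvPolynomial.X i)) * h j =
          MvPolynomial.eval₂ φ a (MvPolynomial.pderiv j p) * h j * a i +
            MvPolynomial.eval₂ φ a p * (if i = j then h j else 0) := by
        intro j
        rw [Derivation.leibniz, MvPolynomial.pderiv_X, Pi.single_apply]
        simp only [smul_eq_mul, MvPolynomial.eval₂_add, MvPolynomial.eval₂_mul,
          MvPolynomial.eval₂_X]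
        split_ifs <;> simp <;> ring
      simp only [this, Finset.sum_add_distrib, ← Finset.sum_mul, ← Finset.mul_sum,
        Finset.sum_ite_eq, Finset.mem_univ, if_true]
    rw [h1, MvPolynomial.eval₂_mul, MvPolynomial.eval₂_mul, hp, MvPolynomial.eval₂_X,
      MvPolynomial.eval₂_X]
    linear_combination h0

/-! ### Functions on infinitesimal disks -/

/-- The polynomials `XᵢXⱼ` that define the disk `𝔻(k) = {ε : Rᵏ | εᵢεⱼ = 0}`. -/
noncomputable def diskPoly (A : Type*) [CommRing A] (k : ℕ) :
    Fin (k * k) → MvPolynomial (Fin k) A :=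
  fun l => MvPolynomial.X (finProdFinEquiv.symm l).1 * MvPolynomial.X (finProdFinEquiv.symm l).2

theorem eval₂_diskPoly_eq_zero {A B : Type*} [CommRing A] [CommRing B] (φ : A →+* B) {k : ℕ}
    (ε : Fin k → B) :
    (∀ l, MvPolynomial.eval₂ φ ε (diskPoly A k l) = 0) ↔ ∀ i j, ε i * ε j = 0 := by
  constructor
  · intro h i j
    simpa [diskPoly] using h (finProdFinEquiv (i, j))
  · intro h l
    simp [diskPoly, h]

/-- The square-zero extension `A ⊕ Aᵏ` detects the coefficients: `Xᵢ ↦ eᵢ` kills all `XᵢXⱼ` and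
sends the linear form to `b`. -/
theorem eq_zero_of_sum_mem_span_diskPoly {A : Type*} [CommRing A] {k : ℕ} (b : Fin k → A)
    (h : ∑ i, MvPolynomial.C (b i) * MvPolynomial.X i ∈
      Ideal.span (Set.range (diskPoly A k))) : b = 0 := by
  let θ := MvPolynomial.aeval (R := A)
    fun i : Fin k => (TrivSqZeroExt.inr (Pi.single i 1) : TrivSqZeroExt A (Fin k → A))
  have hle : Ideal.span (Set.range (diskPoly A k)) ≤ RingHom.ker θ := by
    rw [Ideal.span_le]
    rintro _ ⟨l, rfl⟩
    simp [diskPoly, θ, RingHom.mem_ker]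
  have h1 : θ (∑ i, MvPolynomial.C (b i) * MvPolynomial.X i) = 0 := hle h
  have h2 := congrArg TrivSqZeroExt.snd h1
  funext i
  have h3 := congrFun h2 i
  simpa [θ, TrivSqZeroExt.algebraMap_eq_inl, TrivSqZeroExt.snd_sum, Finset.sum_apply,
    Pi.single_apply] using h3

section KockLawvere

variable {J : GrothendieckTopology C} {R : Cᵒᵖ ⥤ CommRingCat.{w}}

/-- A linear function that vanishes on the disk `𝔻(k)` has coefficients zero. -/
theorem eq_zero_of_disk (hR : Presieve.IsSheaf J (R ⋙ forget CommRingCat))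
    (hduality : Duality J R) {V : C} {k : ℕ} (b : Fin k → R.obj (op V))
    (h : ∀ ⦃W : C⦄ (g : W ⟶ V) (ε : Fin k → R.obj (op W)), (∀ i j, ε i * ε j = 0) →
      ∑ i, res R g (b i) * ε i = 0) (i : Fin k) : b i = 0 := by
  have key := (hduality V k (k * k) (diskPoly _ k)).1
    (∑ i, MvPolynomial.C (b i) * MvPolynomial.X i) fun Y a => by
      simpa [MvPolynomial.eval₂_sum] using h Y.hom a.1 ((eval₂_diskPoly_eq_zero _ _).1 a.2)
  refine res_eq_of_locally hR (Locally.mono key fun W g hg => ?_)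
  have e : (fun l => MvPolynomial.map (res R g) (diskPoly (R.obj (op V)) k l)) =
      diskPoly (R.obj (op W)) k := by
    funext l
    simp [diskPoly]
  rw [e] at hg
  rw [map_zero]
  refine congrFun (eq_zero_of_sum_mem_span_diskPoly (fun i => res R g (b i)) ?_) i
  simpa using hg

/-- Every function on the disk `𝔻(k)` is affine. -/
theorem exists_affine_of_disk (hR : Presieve.IsSheaf J (R ⋙ forget CommRingCat))
    (hduality : Duality J R) {V : C} {k : ℕ}
    (φ : ∀ ⦃W : C⦄ (_ : W ⟶ V) (ε : Fin k → R.obj (op W)), (∀ i j, ε i * ε j = 0) →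
      R.obj (op W))
    (hφ : ∀ ⦃W Z : C⦄ (g : W ⟶ V) (h : Z ⟶ W) (ε : Fin k → R.obj (op W))
      (hε : ∀ i j, ε i * ε j = 0) (hε' : ∀ i j, res R h (ε i) * res R h (ε j) = 0),
      res R h (φ g ε hε) = φ (h ≫ g) (fun i => res R h (ε i)) hε') :
    ∃ b : Fin k → R.obj (op V), ∀ ⦃W : C⦄ (g : W ⟶ V) (ε : Fin k → R.obj (op W))
      (hε : ∀ i j, ε i * ε j = 0), φ g ε hε =
        φ g (fun _ => 0) (fun _ _ => mul_zero _) + ∑ i, res R g (b i) * ε i := by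
  let P : ∀ ⦃W : C⦄ (_ : W ⟶ V), (Fin k → R.obj (op W)) → Prop := fun W g b =>
    ∀ ⦃Z : C⦄ (h : Z ⟶ W) (ε : Fin k → R.obj (op Z)) (hε : ∀ i j, ε i * ε j = 0),
      φ (h ≫ g) ε hε =
        φ (h ≫ g) (fun _ => 0) (fun _ _ => mul_zero _) + ∑ i, res R h (b i) * ε i
  have hPmap : ∀ ⦃W Z : C⦄ (g : W ⟶ V) (h : Z ⟶ W) (b : Fin k → R.obj (op W)), P g b →
      P (h ≫ g) fun i => res R h (b i) := by
    intro W Z g h b hb Z' h' ε hε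
    simpa only [res_comp, Category.assoc] using hb (h' ≫ h) ε hε
  have hPunique : ∀ ⦃W : C⦄ (g : W ⟶ V) (b b' : Fin k → R.obj (op W)), P g b → P g b' →
      b = b' := by
    intro W g b b' hb hb'
    funext i
    refine sub_eq_zero.1 (eq_zero_of_disk hR hduality (fun i => b i - b' i) ?_ i)
    intro Z h ε hε
    have e := (hb h ε hε).symm.trans (hb' h ε hε)
    simpa only [map_sub, sub_mul, Finset.sum_sub_distrib, sub_eq_zero] using add_left_cancel e
  have hPlocal : Locally J fun _ (g : _ ⟶ V) => ∃ b, P g b := by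
    -- Surjectivity in duality represents `φ` locally by a polynomial `p`. On the disk only its
    -- value and its gradient at `0` matter, and the gradient supplies the coefficients.
    let Φ : spec R (diskPoly (R.obj (op V)) k) ⟶ ctx (R ⋙ forget CommRingCat) V :=
      { app := fun Y => ↾fun a => φ Y.unop.hom a.1 ((eval₂_diskPoly_eq_zero _ _).1 a.2)
        naturality := by
          intro Y Y' f
          ext a
          have e := hφ Y.unop.hom f.unop.left a.1 ((eval₂_diskPoly_eq_zero _ _).1 a.2)
            fun i j => by rw [← map_mul, (eval₂_diskPoly_eq_zero _ _).1 a.2, map_zero]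
          refine Eq.trans ?_ e.symm
          change φ Y'.unop.hom (fun i => res R f.unop.left (a.1 i)) _ = _
          congr 1
          exact (Over.w f.unop).symm }
    refine Locally.mono ((hduality V k (k * k) (diskPoly _ k)).2 Φ) fun W g hg => ?_
    obtain ⟨p, hp⟩ := hg
    refine ⟨fun i => MvPolynomial.eval (fun _ => 0) (MvPolynomial.pderiv i p), ?_⟩
    have hp' : ∀ ⦃Z : C⦄ (h : Z ⟶ W) (ε : Fin k → R.obj (op Z)) (hε : ∀ i j, ε i * ε j = 0),
        φ (h ≫ g) ε hε = MvPolynomial.eval₂ (res R h) ε p := fun Z h ε hε =>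
      hp (Over.mk h) ⟨ε, (eval₂_diskPoly_eq_zero _ _).2 hε⟩
    intro Z h ε hε
    rw [hp', hp']
    have t := eval₂_add_of_mul_eq_zero (res R h) (fun _ => 0) ε hε p
    simp only [zero_add] at t
    rw [t]
    congr 1
    refine Finset.sum_congr rfl fun i _ => ?_
    congr 1
    rw [MvPolynomial.eval, MvPolynomial.coe_eval₂Hom, MvPolynomial.eval₂_comp_left]
    simp [Function.comp_def]
  obtain ⟨b, hb⟩ := exists_glue_vector hR hPmap hPunique hPlocal
  refine ⟨b, fun W g ε hε => res_eq_of_locally hR (Locally.mono (hb.pullback g) fun Z h hZ => ?_)⟩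
  have e := hZ (𝟙 Z) (fun i => res R h (ε i)) fun i j => by rw [← map_mul, hε, map_zero]
  simp only [res_id, res_comp, Category.id_comp] at e
  rw [hφ g h ε hε fun i j => by rw [← map_mul, hε, map_zero], map_add, map_sum,
    hφ g h (fun _ => 0) (fun _ _ => mul_zero _) fun i j => by rw [← map_mul, mul_zero, map_zero], e]
  simp only [map_zero, map_mul]

end KockLawvere

/-! ### Points of affine charts -/

section Chart

variable {J : GrothendieckTopology C} {R : Cᵒᵖ ⥤ CommRingCat.{w}} {X : Cᵒᵖ ⥤ Type w}
  {V : C} {n m : ℕ} {f : Fin m → MvPolynomial (Fin n) (R.obj (op V))}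

/-- The vector `a` is a point of the affine scheme, and the chart `c` sends it to `y`. -/
def IsChartPoint (c : spec R f ⟶ ctx X V) {W : C} (k : W ⟶ V) (a : Fin n → R.obj (op W))
    (y : X.obj (op W)) : Prop :=
  ∃ ha : ∀ i, MvPolynomial.eval₂ (res R k) a (f i) = 0,
    c.app (op (Over.mk k)) (⟨a, ha⟩ : (spec R f).obj (op (Over.mk k))) = y

variable {c : spec R f ⟶ ctx X V} {W : C} {k : W ⟶ V}

theorem IsChartPoint.map {a : Fin n → R.obj (op W)} {y : X.obj (op W)}
    (h : IsChartPoint c k a y) {Z : C} (g : Z ⟶ W) :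
    IsChartPoint c (g ≫ k) (fun j => res R g (a j)) (X.map g.op y) := by
  obtain ⟨ha, rfl⟩ := h
  refine ⟨fun i => by rw [eval₂_res_comp, ha, map_zero], ?_⟩
  exact ConcreteCategory.congr_hom
    (c.naturality (Over.homMk g : Over.mk (g ≫ k) ⟶ Over.mk k).op) ⟨a, ha⟩

theorem IsChartPoint.right_unique {a : Fin n → R.obj (op W)} {y z : X.obj (op W)}
    (hy : IsChartPoint c k a y) (hz : IsChartPoint c k a z) : y = z := by
  obtain ⟨_, rfl⟩ := hy
  obtain ⟨_, rfl⟩ := hz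
  rfl

theorem IsChartPoint.left_unique (hc : IsAffineOpenChart J R c) {a b : Fin n → R.obj (op W)}
    {y : X.obj (op W)} (ha : IsChartPoint c k a y) (hb : IsChartPoint c k b y) : a = b := by
  obtain ⟨_, h⟩ := ha
  obtain ⟨_, h'⟩ := hb
  exact congrArg Subtype.val (hc.1 _ (h.trans h'.symm))

theorem mem_range_iff_isChartPoint {y : X.obj (op W)} :
    y ∈ (Subfunctor.range c).obj (op (Over.mk k)) ↔ ∃ a, IsChartPoint c k a y :=
  ⟨fun ⟨a, ha⟩ => ⟨a.1, a.2, ha⟩, fun ⟨a, ha, h⟩ => ⟨⟨a, ha⟩, h⟩⟩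

/-- A chart is injective, so local coordinates of `y` are unique and glue. -/
theorem exists_isChartPoint_of_locally (hR : Presieve.IsSheaf J (R ⋙ forget CommRingCat))
    (hX : Presieve.IsSheaf J X) (hc : IsAffineOpenChart J R c) {y : X.obj (op W)}
    (h : Locally J fun _ (g : _ ⟶ W) => ∃ a, IsChartPoint c (g ≫ k) a (X.map g.op y)) :
    ∃ a, IsChartPoint c k a y := by
  obtain ⟨a, ha⟩ := exists_glue_vector hR
    (P := fun W g a => IsChartPoint c (g ≫ k) a (X.map g.op y))
    (fun W Z g h b hb => by
      rw [map_comp', Category.assoc]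
      exact hb.map h)
    (fun W g b b' hb hb' => hb.left_unique hc hb') h
  have ha0 : ∀ i, MvPolynomial.eval₂ (res R k) a (f i) = 0 := fun i =>
    res_eq_of_locally hR (ha.mono fun Z g hg => by
      rw [← eval₂_res_comp, hg.1 i, map_zero])
  exact ⟨a, ha0, eq_of_locally hX (ha.mono fun Z g hg =>
    (IsChartPoint.map ⟨ha0, rfl⟩ g).right_unique hg)⟩

/-- The Jacobian at the point `a` of a chart. -/
noncomputable abbrev chartJacobian (f : Fin m → MvPolynomial (Fin n) (R.obj (op V)))
    {W : C} (k : W ⟶ V) (a : Fin n → R.obj (op W)) : Matrix (Fin m) (Fin n) (R.obj (op W)) :=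
  jacobianAt (fun i => MvPolynomial.map (res R k) (f i)) a

theorem chartJacobian_apply (a : Fin n → R.obj (op W)) (i : Fin m) (j : Fin n) :
    chartJacobian f k a i j = MvPolynomial.eval₂ (res R k) a (MvPolynomial.pderiv j (f i)) := by
  rw [chartJacobian, jacobianAt, Matrix.of_apply, MvPolynomial.pderiv_map, MvPolynomial.eval_map]

theorem chartJacobian_map (a : Fin n → R.obj (op W)) {Z : C} (g : Z ⟶ W) :
    (chartJacobian f k a).map (res R g) =
      chartJacobian f (g ≫ k) fun j => res R g (a j) := by
  ext i j
  rw [Matrix.map_apply, chartJacobian_apply, chartJacobian_apply, eval₂_res_comp]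

/-- The value of the equations of a chart at an infinitesimal neighbour of the point `a`. -/
theorem eval₂_disk (a : Fin n → R.obj (op W)) {i : Fin m}
    (ha : MvPolynomial.eval₂ (res R k) a (f i) = 0)
    {p : ℕ} (v : Fin p → Fin n → R.obj (op W)) {Z : C} (g : Z ⟶ W) (ε : Fin p → R.obj (op Z))
    (hε : ∀ i j, ε i * ε j = 0) :
    MvPolynomial.eval₂ (res R (g ≫ k))
        (fun j => res R g (a j) + ∑ l, ε l * res R g (v l j)) (f i) =
      ∑ l, res R g ((chartJacobian f k a).mulVec (v l) i) * ε l := by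
  rw [eval₂_add_of_mul_eq_zero]
  · rw [eval₂_res_comp, ha, map_zero, zero_add]
    simp only [Matrix.mulVec, dotProduct, map_sum, map_mul, eval₂_res_comp, chartJacobian_apply,
      Finset.sum_mul, Finset.mul_sum]
    rw [Finset.sum_comm]
    exact Finset.sum_congr rfl fun l _ => Finset.sum_congr rfl fun j _ => by ring
  · intro j j'
    rw [Finset.sum_mul_sum]
    exact Finset.sum_eq_zero fun l _ => Finset.sum_eq_zero fun l' _ => by
      rw [mul_mul_mul_comm, hε, zero_mul]

/-- A map from the disk `𝔻(p)` to `X` through a point of a chart is affine in the chart. -/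
theorem exists_affine_in_chart (hR : Presieve.IsSheaf J (R ⋙ forget CommRingCat))
    (hlocal : Locality J R) (hduality : Duality J R) (hX : Presieve.IsSheaf J X)
    (hc : IsAffineOpenChart J R c) {a : Fin n → R.obj (op W)} {x : X.obj (op W)}
    (ha : IsChartPoint c k a x) {p : ℕ}
    (σ : ∀ ⦃Z : C⦄ (_ : Z ⟶ W) (ε : Fin p → R.obj (op Z)), (∀ i j, ε i * ε j = 0) →
      X.obj (op Z))
    (hσ : ∀ ⦃Z Z' : C⦄ (g : Z ⟶ W) (h : Z' ⟶ Z) (ε : Fin p → R.obj (op Z))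
      (hε : ∀ i j, ε i * ε j = 0) (hε' : ∀ i j, res R h (ε i) * res R h (ε j) = 0),
      X.map h.op (σ g ε hε) = σ (h ≫ g) (fun i => res R h (ε i)) hε')
    (hσ0 : σ (𝟙 W) (fun _ => 0) (fun _ _ => mul_zero _) = x) :
    ∃ v : Fin p → Fin n → R.obj (op W), (∀ l, (chartJacobian f k a).mulVec (v l) = 0) ∧
      ∀ ⦃Z : C⦄ (g : Z ⟶ W) (ε : Fin p → R.obj (op Z)) (hε : ∀ i j, ε i * ε j = 0),
        IsChartPoint c (g ≫ k) (fun j => res R g (a j) + ∑ l, ε l * res R g (v l j))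
          (σ g ε hε) := by
  have h0 : ∀ ⦃Z : C⦄ (g : Z ⟶ W),
      IsChartPoint c (g ≫ k) (fun j => res R g (a j))
        (σ g (fun _ => 0) fun _ _ => mul_zero _) := by
    intro Z g
    have e := hσ (𝟙 W) g (fun _ => 0) (fun _ _ => mul_zero _) fun _ _ => by
      rw [map_zero, mul_zero]
    simp only [map_zero, hσ0, Category.comp_id] at e
    rw [← e]
    exact ha.map g
  have h1 : ∀ ⦃Z : C⦄ (g : Z ⟶ W) (ε : Fin p → R.obj (op Z)) (hε : ∀ i j, ε i * ε j = 0),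
      ∃ b, IsChartPoint c (g ≫ k) b (σ g ε hε) := by
    intro Z g ε hε
    refine exists_isChartPoint_of_locally hR hX hc (Locally.mono
      (hc.2.locally_mem hR hlocal hduality (g ≫ k) (σ g ε hε) ε hε fun Z' h hz => ?_)
      fun Z' h hz => mem_range_iff_isChartPoint.1 hz)
    -- Where `ε` vanishes, the value of `σ` is the restriction of `x`, whose coordinates are those
    -- of `a`.
    refine mem_range_iff_isChartPoint.2 ⟨fun j => res R (h ≫ g) (a j), ?_⟩
    rw [hσ g h ε hε fun i j => by rw [hz, zero_mul], ← Category.assoc]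
    simpa only [hz] using h0 (h ≫ g)
  choose b hb using h1
  have hb0 : ∀ ⦃Z : C⦄ (g : Z ⟶ W),
      b g (fun _ => 0) (fun _ _ => mul_zero _) = fun j => res R g (a j) :=
    fun Z g => (hb g _ _).left_unique hc (h0 g)
  -- The coordinates `b` were chosen stage by stage; their uniqueness makes them natural, so each is
  -- a function on the disk.
  have hv := fun j => exists_affine_of_disk hR hduality (fun Z g ε hε => b g ε hε j) (by
    intro Z Z' g h ε hε hε'
    have e := (hb g ε hε).map h
    rw [hσ g h ε hε hε', ← Category.assoc] at e
    exact congrFun (e.left_unique hc (hb _ _ _)) j)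
  choose v hv using hv
  have hpt : ∀ ⦃Z : C⦄ (g : Z ⟶ W) (ε : Fin p → R.obj (op Z)) (hε : ∀ i j, ε i * ε j = 0),
      IsChartPoint c (g ≫ k) (fun j => res R g (a j) + ∑ l, ε l * res R g (v j l))
        (σ g ε hε) := by
    intro Z g ε hε
    convert hb g ε hε using 2 with j
    rw [hv j g ε hε, hb0]
    simp only [mul_comm]
  refine ⟨fun l j => v j l, fun l => funext fun i => ?_, hpt⟩
  -- The equations of the chart hold at `a + ∑ εₗvₗ` for every `ε`, so the linear form in `ε` to
  -- which they reduce has coefficients zero.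
  refine eq_zero_of_disk hR hduality
    (fun l => (chartJacobian f k a).mulVec (fun j => v j l) i) (fun Z g ε hε => ?_) l
  rw [← eval₂_disk a (ha.1 i) (fun l j => v j l) g ε hε]
  exact (hpt g ε hε).1 i

end Chart

/-! ### Maps in a context -/

section Maps

variable {F G : Cᵒᵖ ⥤ Type w} {V : C}

/-- The value of a map `F → G` in the context `V` at an element of `F` at the later stage `g`. -/
def appAt (t : ctx F V ⟶ ctx G V) {W : C} (g : W ⟶ V) (y : F.obj (op W)) : G.obj (op W) :=
  t.app (op (Over.mk g)) y

theorem map_appAt (t : ctx F V ⟶ ctx G V) {W Z : C} (g : W ⟶ V) (h : Z ⟶ W)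
    (y : F.obj (op W)) : G.map h.op (appAt t g y) = appAt t (h ≫ g) (F.map h.op y) :=
  (ConcreteCategory.congr_hom
    (t.naturality (Over.homMk h : Over.mk (h ≫ g) ⟶ Over.mk g).op) y).symm

theorem appAt_ext {s t : ctx F V ⟶ ctx G V}
    (h : ∀ ⦃W : C⦄ (g : W ⟶ V) (y : F.obj (op W)), appAt s g y = appAt t g y) : s = t := by
  apply NatTrans.ext
  funext Y
  exact ConcreteCategory.hom_ext _ _ fun y => h Y.unop.hom y

/-- A map in the context `V` from its values at the later stages. -/
def ofAppAt (t : ∀ ⦃W : C⦄ (_ : W ⟶ V), F.obj (op W) → G.obj (op W))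
    (ht : ∀ ⦃W Z : C⦄ (g : W ⟶ V) (h : Z ⟶ W) (y : F.obj (op W)),
      G.map h.op (t g y) = t (h ≫ g) (F.map h.op y)) : ctx F V ⟶ ctx G V where
  app Y := ↾fun y => t Y.unop.hom y
  naturality Y Y' φ := by
    refine ConcreteCategory.hom_ext _ _ fun y => ?_
    refine Eq.trans ?_ (ht Y.unop.hom φ.unop.left y).symm
    rw [Over.w φ.unop]
    rfl

theorem appAt_ofAppAt (t : ∀ ⦃W : C⦄ (_ : W ⟶ V), F.obj (op W) → G.obj (op W)) (ht)
    {W : C} (g : W ⟶ V) (y : F.obj (op W)) :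
    appAt (ofAppAt (G := G) t ht) g y = t g y := rfl

/-- The restriction of a map to a later stage. -/
def resHom (t : ctx F V ⟶ ctx G V) {W : C} (g : W ⟶ V) : ctx F W ⟶ ctx G W :=
  (presheafHom F G).map g.op t

theorem appAt_resHom (t : ctx F V ⟶ ctx G V) {W Z : C} (g : W ⟶ V) (h : Z ⟶ W)
    (y : F.obj (op Z)) : appAt (resHom t g) h y = appAt t (h ≫ g) y := rfl

theorem resHom_comp (t : ctx F V ⟶ ctx G V) {W Z : C} (h : Z ⟶ W) (g : W ⟶ V) :
    resHom t (h ≫ g) = resHom (resHom t g) h :=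
  map_comp' (X := presheafHom F G) h g t

end Maps

/-! ### Points of infinitesimal disks -/

section Disks

variable {R : Cᵒᵖ ⥤ CommRingCat.{w}} {V W : C}

/-- The point `ε` of `𝔻(1)`. -/
def mkD1 (ε : R.obj (op V)) (h : ε ^ 2 = 0) : (D1 R).obj (op V) := ⟨ε, h⟩

/-- The point `(ε, δ)` of `𝔻(2)`. -/
def mkD2 (ε δ : R.obj (op V)) (h : ε ^ 2 = 0 ∧ ε * δ = 0 ∧ δ ^ 2 = 0) : (D2 R).obj (op V) :=
  ⟨(ε, δ), h⟩

theorem map_mkD1 (ε : R.obj (op V)) (h : ε ^ 2 = 0) (g : W ⟶ V) :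
    (D1 R).map g.op (mkD1 ε h) = mkD1 (res R g ε) (by rw [← map_pow, h, map_zero]) := rfl

theorem map_mkD2 (ε δ : R.obj (op V)) (h : ε ^ 2 = 0 ∧ ε * δ = 0 ∧ δ ^ 2 = 0) (g : W ⟶ V) :
    (D2 R).map g.op (mkD2 ε δ h) = mkD2 (res R g ε) (res R g δ)
      (by simp only [← map_pow, ← map_mul, h, map_zero, and_self]) := rfl

theorem mkD1_val (ε : (D1 R).obj (op V)) : mkD1 ε.1 ε.2 = ε := rfl

theorem mkD2_val (q : (D2 R).obj (op V)) : mkD2 q.1.1 q.1.2 q.2 = q := rfl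

theorem inl_app_val (ε : (D1 R).obj (op V)) : ((inl R).app (op V) ε).1 = (ε.1, 0) := rfl

theorem inr_app_val (ε : (D1 R).obj (op V)) : ((inr R).app (op V) ε).1 = (0, ε.1) := rfl

theorem map_inl (ε : (D1 R).obj (op V)) (g : W ⟶ V) :
    (D2 R).map g.op ((inl R).app (op V) ε) = (inl R).app (op W) ((D1 R).map g.op ε) :=
  (ConcreteCategory.congr_hom ((inl R).naturality g.op) ε).symm

theorem map_inr (ε : (D1 R).obj (op V)) (g : W ⟶ V) :
    (D2 R).map g.op ((inr R).app (op V) ε) = (inr R).app (op W) ((D1 R).map g.op ε) :=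
  (ConcreteCategory.congr_hom ((inr R).naturality g.op) ε).symm

theorem map_zeroD1 (g : W ⟶ V) :
    (D1 R).map g.op (zeroD1 R (op V)) = zeroD1 R (op W) :=
  Subtype.ext (map_zero (res R g))

end Disks

/-! ### Tangent vectors in charts -/

/-- The standing assumptions: `R` satisfies the axioms of synthetic algebraic geometry and `X` is
a scheme. -/
structure SchemeAxioms (J : GrothendieckTopology C) (R : Cᵒᵖ ⥤ CommRingCat.{w})
    (X : Cᵒᵖ ⥤ Type w) : Prop where
  isSheaf_ring : Presieve.IsSheaf J (R ⋙ forget CommRingCat)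
  locality : Locality J R
  duality : Duality J R
  isSheaf : Presieve.IsSheaf J X
  isScheme : IsScheme J R X

/-- An affine open chart through the restriction of `x` along `g`. -/
structure ChartAt (J : GrothendieckTopology C) (R : Cᵒᵖ ⥤ CommRingCat.{w}) {X : Cᵒᵖ ⥤ Type w}
    {V : C} (x : X.obj (op V)) {W : C} (g : W ⟶ V) where
  -- The chart may live at a stage `base` other than `W`: restriction then keeps the equations and
  -- `c`, and changes only `k` and `a`.
  base : C
  k : W ⟶ base
  n : ℕ
  m : ℕ
  f : Fin m → MvPolynomial (Fin n) (R.obj (op base))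
  c : spec R f ⟶ ctx X base
  isChart : IsAffineOpenChart J R c
  a : Fin n → R.obj (op W)
  isChartPoint : IsChartPoint c k a (X.map g.op x)

section Tangent

variable {J : GrothendieckTopology C} {R : Cᵒᵖ ⥤ CommRingCat.{w}} {X : Cᵒᵖ ⥤ Type w} {V : C}
  {x : X.obj (op V)}

theorem SchemeAxioms.locally_chartAt (H : SchemeAxioms J R X) (x : X.obj (op V)) :
    Locally J fun _ (g : _ ⟶ V) => Nonempty (ChartAt J R x g) := by
  refine Locally.bind (H.isScheme V) fun W g hg => ?_
  obtain ⟨p, n, m, f, c, hc, hcover⟩ := hg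
  refine Locally.mono (hcover (Over.mk (𝟙 W)) (X.map g.op x)) fun Z h hh => ?_
  obtain ⟨i, hi⟩ := hh
  obtain ⟨a, ha⟩ := mem_range_iff_isChartPoint.1 hi
  exact ⟨⟨W, _, n i, m i, f i, c i, hc i, a, by rw [map_comp']; exact ha⟩⟩

/-- The restriction of a chart to a later stage. -/
abbrev ChartAt.restrict {W : C} {g : W ⟶ V} (P : ChartAt J R x g) {V' Z : C} (h : Z ⟶ W)
    (g' : Z ⟶ V') (x' : X.obj (op V')) (hx : X.map g'.op x' = X.map (h ≫ g).op x) :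
    ChartAt J R x' g' where
  base := P.base
  k := h ≫ P.k
  n := P.n
  m := P.m
  f := P.f
  c := P.c
  isChart := P.isChart
  a := fun j => res R h (P.a j)
  isChartPoint := by
    rw [hx, map_comp']
    exact P.isChartPoint.map h

/-- The tangent vectors at `x`. -/
def Tangent (R : Cᵒᵖ ⥤ CommRingCat.{w}) {X : Cᵒᵖ ⥤ Type w} {V : C} (x : X.obj (op V)) :
    Type (max u v w) :=
  {t : ctx (D1 R) V ⟶ ctx X V // t.app (op (Over.mk (𝟙 V))) (zeroD1 R (op V)) = x}

theorem Tangent.appAt_zero (t : Tangent R x) {W : C} (g : W ⟶ V) :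
    appAt t.1 g (zeroD1 R (op W)) = X.map g.op x := by
  have h := map_appAt t.1 (𝟙 V) g (zeroD1 R (op V))
  rw [map_zeroD1, Category.comp_id] at h
  rw [← h]
  exact congrArg _ t.2

variable {W : C} {g : W ⟶ V}

/-- In the chart, `t(ε) = c(a + εv)`. -/
def HasDirection (P : ChartAt J R x g) (t : ctx (D1 R) V ⟶ ctx X V)
    (v : Fin P.n → R.obj (op W)) : Prop :=
  ∀ ⦃Z : C⦄ (h : Z ⟶ W) (ε : (D1 R).obj (op Z)),
    IsChartPoint P.c (h ≫ P.k) (fun j => res R h (P.a j) + ε.1 * res R h (v j))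
      (appAt t (h ≫ g) ε)

/-- In the chart, `ψ(ε, δ) = c(a + εv + δw)`. -/
def HasDirections (P : ChartAt J R x g) (ψ : ctx (D2 R) V ⟶ ctx X V)
    (v w : Fin P.n → R.obj (op W)) : Prop :=
  ∀ ⦃Z : C⦄ (h : Z ⟶ W) (q : (D2 R).obj (op Z)),
    IsChartPoint P.c (h ≫ P.k)
      (fun j => res R h (P.a j) + (q.1.1 * res R h (v j) + q.1.2 * res R h (w j)))
      (appAt ψ (h ≫ g) q)

/-- The Jacobian of the equations of the chart at its distinguished point. -/
noncomputable abbrev ChartAt.jacobian (P : ChartAt J R x g) :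
    Matrix (Fin P.m) (Fin P.n) (R.obj (op W)) :=
  chartJacobian P.f P.k P.a

theorem HasDirection.unique (H : SchemeAxioms J R X) {P : ChartAt J R x g}
    {t : ctx (D1 R) V ⟶ ctx X V} {v v' : Fin P.n → R.obj (op W)} (hv : HasDirection P t v)
    (hv' : HasDirection P t v') : v = v' := by
  funext j
  refine sub_eq_zero.1 (eq_zero_of_disk H.isSheaf_ring H.duality (k := 1)
    (fun _ => v j - v' j) (fun Z h ε hε => ?_) 0)
  let ε' : (D1 R).obj (op Z) := ⟨ε 0, by rw [pow_two, hε]⟩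
  have e := add_left_cancel (congrFun ((hv h ε').left_unique P.isChart (hv' h ε')) j)
  have e' : ε 0 * res R h (v j) = ε 0 * res R h (v' j) := e
  rw [Fin.sum_univ_one, map_sub]
  linear_combination e'

theorem exists_hasDirection (H : SchemeAxioms J R X) (P : ChartAt J R x g) (t : Tangent R x) :
    ∃ v, P.jacobian.mulVec v = 0 ∧ HasDirection P t.1 v := by
  obtain ⟨v, hv, hσ⟩ := exists_affine_in_chart H.isSheaf_ring H.locality H.duality H.isSheaf
    P.isChart P.isChartPoint (p := 1)
    (fun Z h ε hε => appAt t.1 (h ≫ g) (mkD1 (ε 0) (by rw [pow_two, hε])))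
    (fun Z Z' h h' ε hε hε' => by rw [map_appAt, Category.assoc, map_mkD1])
    (by rw [Category.id_comp]; exact t.appAt_zero g)
  refine ⟨v 0, hv 0, fun Z h ε => ?_⟩
  simpa [mkD1_val] using hσ h (fun _ => ε.1) fun _ _ => by rw [← pow_two]; exact ε.2

theorem exists_hasDirections (H : SchemeAxioms J R X) (P : ChartAt J R x g)
    {ψ : ctx (D2 R) V ⟶ ctx X V}
    (hψ : appAt ψ g ((inl R).app _ (zeroD1 R (op W))) = X.map g.op x) :
    ∃ v w, HasDirections P ψ v w := by
  obtain ⟨v, -, hσ⟩ := exists_affine_in_chart H.isSheaf_ring H.locality H.duality H.isSheaf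
    P.isChart P.isChartPoint (p := 2)
    (fun Z h ε hε => appAt ψ (h ≫ g)
      (mkD2 (ε 0) (ε 1) ⟨by rw [pow_two, hε], hε 0 1, by rw [pow_two, hε]⟩))
    (fun Z Z' h h' ε hε hε' => by rw [map_appAt, Category.assoc, map_mkD2])
    (by rw [Category.id_comp]; exact hψ)
  refine ⟨v 0, v 1, fun Z h q => ?_⟩
  have hq := q.2
  have := hσ h ![q.1.1, q.1.2] fun i j => by
    fin_cases i <;> fin_cases j <;> simp [← pow_two, hq.1, hq.2.1, hq.2.2, mul_comm q.1.2 q.1.1]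
  simpa [mkD2_val] using this

/-! ### Extension of two tangent vectors to `𝔻(2)` -/

theorem extends_iff {ψ : ctx (D2 R) V ⟶ ctx X V} {s t : ctx (D1 R) V ⟶ ctx X V} :
    Extends ψ s t ↔ ∀ ⦃W : C⦄ (g : W ⟶ V) (ε : (D1 R).obj (op W)),
      appAt ψ g ((inl R).app _ ε) = appAt s g ε ∧ appAt ψ g ((inr R).app _ ε) = appAt t g ε := by
  constructor
  · rintro ⟨rfl, rfl⟩ W g ε
    exact ⟨rfl, rfl⟩
  · exact fun h => ⟨appAt_ext fun W g ε => (h g ε).1, appAt_ext fun W g ε => (h g ε).2⟩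

/-- `ψ` is affine in the chart, and its two directions can be read off on the axes, where it agrees
with `s` and `t`. -/
theorem Extends.hasDirections (H : SchemeAxioms J R X) {P : ChartAt J R x g}
    {ψ : ctx (D2 R) V ⟶ ctx X V} {s t : Tangent R x} (h : Extends ψ s.1 t.1)
    {v w : Fin P.n → R.obj (op W)} (hv : HasDirection P s.1 v) (hw : HasDirection P t.1 w) :
    HasDirections P ψ v w := by
  rw [extends_iff] at h
  obtain ⟨v', w', hψ⟩ := exists_hasDirections H P ((h g _).1.trans (s.appAt_zero g))
  have e : v = v' := hv.unique H fun Z l ε => by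
    have := hψ l ((inl R).app _ ε)
    rw [(h _ ε).1] at this
    simpa [inl_app_val] using this
  have e' : w = w' := hw.unique H fun Z l ε => by
    have := hψ l ((inr R).app _ ε)
    rw [(h _ ε).2] at this
    simpa [inr_app_val] using this
  rwa [e, e']

theorem HasDirections.diag {P : ChartAt J R x g} {ψ : ctx (D2 R) V ⟶ ctx X V}
    {v w : Fin P.n → R.obj (op W)} (h : HasDirections P ψ v w) :
    HasDirection P (Functor.whiskerLeft (Over.forget V).op (diag R) ≫ ψ) (v + w) := by
  intro Z l ε
  have := h l ((SynAG.diag R).app _ ε)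
  simp only [Pi.add_apply, map_add, mul_add]
  exact this

/-- Maps `F → X` that agree near every chart are equal. -/
theorem eq_of_chartAt (H : SchemeAxioms J R X) {F : Cᵒᵖ ⥤ Type w} (x : X.obj (op V))
    {s t : ctx F V ⟶ ctx X V}
    (h : ∀ ⦃W : C⦄ (g : W ⟶ V) (_ : ChartAt J R x g) (y : F.obj (op W)),
      appAt s g y = appAt t g y) : s = t := by
  refine appAt_ext fun W g y => eq_of_locally H.isSheaf
    (((H.locally_chartAt x).pullback g).mono fun Z l hl => ?_)
  rw [map_appAt, map_appAt]
  exact h _ hl.some _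

theorem HasDirection.appAt_eq {P : ChartAt J R x g} {s t : ctx (D1 R) V ⟶ ctx X V}
    {v : Fin P.n → R.obj (op W)} (hs : HasDirection P s v) (ht : HasDirection P t v)
    (ε : (D1 R).obj (op W)) : appAt s g ε = appAt t g ε := by
  simpa using (hs (𝟙 W) ε).right_unique (ht (𝟙 W) ε)

theorem HasDirections.appAt_eq {P : ChartAt J R x g} {ψ ψ' : ctx (D2 R) V ⟶ ctx X V}
    {v w : Fin P.n → R.obj (op W)} (h : HasDirections P ψ v w) (h' : HasDirections P ψ' v w)
    (q : (D2 R).obj (op W)) : appAt ψ g q = appAt ψ' g q := by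
  simpa using (h (𝟙 W) q).right_unique (h' (𝟙 W) q)

theorem Extends.unique (H : SchemeAxioms J R X) {ψ ψ' : ctx (D2 R) V ⟶ ctx X V}
    {s t : Tangent R x} (h : Extends ψ s.1 t.1) (h' : Extends ψ' s.1 t.1) : ψ = ψ' := by
  refine eq_of_chartAt H x fun W g P q => ?_
  obtain ⟨v, -, hv⟩ := exists_hasDirection H P s
  obtain ⟨w, -, hw⟩ := exists_hasDirection H P t
  exact (h.hasDirections H hv hw).appAt_eq (h'.hasDirections H hv hw) q

/-- An infinitesimal neighbour of the point of a chart in a tangent direction lies on the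
chart. -/
theorem exists_isChartPoint_of_jacobian (P : ChartAt J R x g) {p : ℕ}
    {v : Fin p → Fin P.n → R.obj (op W)} (hv : ∀ l, P.jacobian.mulVec (v l) = 0) {Z : C}
    (h : Z ⟶ W) (ε : Fin p → R.obj (op Z)) (hε : ∀ i j, ε i * ε j = 0) :
    ∃ y, IsChartPoint P.c (h ≫ P.k)
      (fun j => res R h (P.a j) + ∑ l, ε l * res R h (v l j)) y := by
  refine ⟨_, fun i => ?_, rfl⟩
  rw [eval₂_disk P.a (P.isChartPoint.1 i) v h ε hε]
  exact Finset.sum_eq_zero fun l _ => by rw [hv l, Pi.zero_apply, map_zero, zero_mul]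

/-- Surjectivity onto the kernel: by Taylor expansion `a + εv` satisfies the equations, so `ε ↦ c(a
+ εv)` is defined. -/
theorem exists_tangent_of_jacobian (P : ChartAt J R x (𝟙 V)) {v : Fin P.n → R.obj (op V)}
    (hv : P.jacobian.mulVec v = 0) : ∃ t : Tangent R x, HasDirection P t.1 v := by
  have key : ∀ ⦃Z : C⦄ (h : Z ⟶ V) (ε : (D1 R).obj (op Z)), ∃ y,
      IsChartPoint P.c (h ≫ P.k) (fun j => res R h (P.a j) + ε.1 * res R h (v j)) y := by
    intro Z h ε
    simpa using exists_isChartPoint_of_jacobian P (v := fun _ : Fin 1 => v) (fun _ => hv) h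
      (fun _ => ε.1) fun _ _ => by rw [← pow_two]; exact ε.2
  choose t ht using key
  refine ⟨⟨ofAppAt t fun W Z g h ε => ?_, ?_⟩, fun Z h ε => ?_⟩
  · refine ((ht g ε).map h).right_unique ?_
    have := ht (h ≫ g) ((D1 R).map h.op ε)
    rw [Category.assoc] at this
    convert this using 2 with j
    rw [map_add, map_mul, res_comp, res_comp]
    rfl
  · refine (ht (𝟙 V) (zeroD1 R (op V))).right_unique ?_
    have := P.isChartPoint
    rw [map_id'] at this
    simpa [zeroD1, res_id] using this
  · rw [appAt_ofAppAt, Category.comp_id]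
    exact ht h ε

theorem exists_extends_of_chartAt (H : SchemeAxioms J R X) (P : ChartAt J R x (𝟙 V))
    (s t : Tangent R x) : ∃ ψ, Extends ψ s.1 t.1 := by
  obtain ⟨v, hv0, hv⟩ := exists_hasDirection H P s
  obtain ⟨w, hw0, hw⟩ := exists_hasDirection H P t
  have key : ∀ ⦃Z : C⦄ (h : Z ⟶ V) (q : (D2 R).obj (op Z)), ∃ y, IsChartPoint P.c (h ≫ P.k)
      (fun j => res R h (P.a j) + (q.1.1 * res R h (v j) + q.1.2 * res R h (w j))) y := by
    intro Z h q
    have hq := q.2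
    have := exists_isChartPoint_of_jacobian P (v := ![v, w])
      (fun l => by fin_cases l <;> simp [hv0, hw0]) h ![q.1.1, q.1.2] fun i j => by
        fin_cases i <;> fin_cases j <;>
          simp [← pow_two, hq.1, hq.2.1, hq.2.2, mul_comm q.1.2 q.1.1]
    simpa using this
  choose ψ hψ using key
  refine ⟨ofAppAt ψ fun W Z g h q => ?_, extends_iff.2 fun W g ε => ⟨?_, ?_⟩⟩
  · refine ((hψ g q).map h).right_unique ?_
    have := hψ (h ≫ g) ((D2 R).map h.op q)
    rw [Category.assoc] at this
    convert this using 2 with j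
    rw [map_add, map_add, map_mul, map_mul, res_comp, res_comp, res_comp]
    rfl
  · refine (hψ g ((inl R).app _ ε)).right_unique ?_
    have := hv g ε
    rw [Category.comp_id] at this
    simpa [inl_app_val] using this
  · refine (hψ g ((inr R).app _ ε)).right_unique ?_
    have := hw g ε
    rw [Category.comp_id] at this
    simpa [inr_app_val] using this

/-- The restriction of a tangent vector to a later stage. -/
def Tangent.restrict (t : Tangent R x) (g : W ⟶ V) (x' : X.obj (op W))
    (hx : X.map g.op x = x') : Tangent R x' :=
  ⟨resHom t.1 g, by
    rw [← hx, ← t.appAt_zero g]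
    change appAt (resHom t.1 g) (𝟙 W) (zeroD1 R (op W)) = _
    rw [appAt_resHom, Category.id_comp]⟩

theorem Extends.restrict {ψ : ctx (D2 R) V ⟶ ctx X V} {s t : ctx (D1 R) V ⟶ ctx X V}
    (h : Extends ψ s t) (g : W ⟶ V) :
    Extends (resHom ψ g) (resHom s g) (resHom t g) :=
  extends_iff.2 fun _ l ε => extends_iff.1 h (l ≫ g) ε

theorem existsUnique_extends (H : SchemeAxioms J R X) (s t : Tangent R x) :
    ∃! ψ, Extends ψ s.1 t.1 := by
  refine existsUnique_of_exists_of_unique ?_ fun ψ ψ' h h' => h.unique H h'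
  -- Maps into a sheaf form a sheaf, so the extensions built in charts glue by uniqueness.
  have hS : Presieve.IsSheaf J (presheafHom (D2 R) X) :=
    (isSheaf_iff_isSheaf_of_type J _).1
      (Presheaf.IsSheaf.hom (D2 R) X ((isSheaf_iff_isSheaf_of_type J X).2 H.isSheaf))
  obtain ⟨ψ, hψ⟩ : ∃ ψ : ctx (D2 R) V ⟶ ctx X V, Locally J fun _ (g : _ ⟶ V) =>
      Extends (resHom ψ g) (resHom s.1 g) (resHom t.1 g) := exists_glue hS
    (P := fun W g ψ => Extends (V := W) ψ (resHom s.1 g) (resHom t.1 g))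
    (fun W Z g k ψ h => by
      rw [resHom_comp, resHom_comp]
      exact Extends.restrict h k)
    (fun W g ψ ψ' h h' => Extends.unique H (s := s.restrict g _ rfl) (t := t.restrict g _ rfl)
      h h')
    ((H.locally_chartAt x).mono fun W g P => exists_extends_of_chartAt H
      (P.some.restrict (𝟙 W) (𝟙 W) (X.map g.op x) (by rw [map_comp']))
      (s.restrict g _ rfl) (t.restrict g _ rfl))
  refine ⟨ψ, extends_iff.2 fun W g ε => ⟨?_, ?_⟩⟩
  · refine eq_of_locally H.isSheaf ((hψ.pullback g).mono fun Z l hl => ?_)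
    have e := (extends_iff.1 hl (𝟙 Z) ((D1 R).map l.op ε)).1
    rw [appAt_resHom, appAt_resHom, Category.id_comp] at e
    rw [map_appAt, map_appAt, map_inl]
    exact e
  · refine eq_of_locally H.isSheaf ((hψ.pullback g).mono fun Z l hl => ?_)
    have e := (extends_iff.1 hl (𝟙 Z) ((D1 R).map l.op ε)).2
    rw [appAt_resHom, appAt_resHom, Category.id_comp] at e
    rw [map_appAt, map_appAt, map_inr]
    exact e

end Tangent

/-! ### The module structure on the tangent space -/

section Module

variable {J : GrothendieckTopology C} {R : Cᵒᵖ ⥤ CommRingCat.{w}} {X : Cᵒᵖ ⥤ Type w} {V W : C}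
  {x : X.obj (op V)} {g : W ⟶ V}

/-- The direction of a tangent vector in a chart. -/
noncomputable def direction (H : SchemeAxioms J R X) (P : ChartAt J R x g) (t : Tangent R x) :
    Fin P.n → R.obj (op W) :=
  (exists_hasDirection H P t).choose

theorem jacobian_mulVec_direction (H : SchemeAxioms J R X) (P : ChartAt J R x g)
    (t : Tangent R x) : P.jacobian.mulVec (direction H P t) = 0 :=
  (exists_hasDirection H P t).choose_spec.1

theorem hasDirection_direction (H : SchemeAxioms J R X) (P : ChartAt J R x g)
    (t : Tangent R x) : HasDirection P t.1 (direction H P t) :=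
  (exists_hasDirection H P t).choose_spec.2

/-- This reduces each module law to the same law for vectors over `R`, without a chart at the stage
`V` itself. -/
theorem Tangent.ext_direction (H : SchemeAxioms J R X) {s t : Tangent R x}
    (h : ∀ ⦃W : C⦄ (g : W ⟶ V) (P : ChartAt J R x g), direction H P s = direction H P t) :
    s = t :=
  Subtype.ext (eq_of_chartAt H x fun _ g P y =>
    (hasDirection_direction H P s).appAt_eq (h g P ▸ hasDirection_direction H P t) y)

theorem Tangent.ext_direction_id (H : SchemeAxioms J R X) (P : ChartAt J R x (𝟙 V))
    {s t : Tangent R x} (h : direction H P s = direction H P t) : s = t :=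
  Subtype.ext (appAt_ext fun Z g ε => by
    have hs := hasDirection_direction H P s g ε
    have ht := hasDirection_direction H P t g ε
    rw [Category.comp_id] at hs ht
    rw [h] at hs
    exact hs.right_unique ht)

/-- The zero tangent vector. -/
def Tangent.zero (R : Cᵒᵖ ⥤ CommRingCat.{w}) (x : X.obj (op V)) : Tangent R x :=
  ⟨ofAppAt (fun _ g _ => X.map g.op x) fun _ _ g h _ => (map_comp' h g x).symm, map_id' x⟩

theorem appAt_scale_comp (t : ctx (D1 R) V ⟶ ctx X V) (r : R.obj (op V)) (g : W ⟶ V)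
    (ε : (D1 R).obj (op W)) : appAt (scale R r ≫ t) g ε =
      appAt t g (mkD1 (res R g r * ε.1) (by rw [mul_pow, ε.2, mul_zero])) := rfl

/-- The multiple of a tangent vector by a scalar. -/
def Tangent.smul (r : R.obj (op V)) (t : Tangent R x) : Tangent R x :=
  ⟨scale R r ≫ t.1, by
    refine (appAt_scale_comp t.1 r (𝟙 V) (zeroD1 R (op V))).trans (Eq.trans ?_ t.2)
    exact congrArg (appAt t.1 (𝟙 V)) (Subtype.ext (mul_zero _))⟩

open Classical in
/-- The sum of two tangent vectors. -/
noncomputable def Tangent.add (s t : Tangent R x) : Tangent R x :=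
  -- The case distinction makes the sum total without the axioms; on a scheme the default `s` is
  -- never taken.
  if h : ∃ ψ, Extends ψ s.1 t.1 then
    ⟨Functor.whiskerLeft (Over.forget V).op (diag R) ≫ h.choose, by
      refine Eq.trans ?_ s.2
      exact (extends_iff.1 h.choose_spec (𝟙 V) (zeroD1 R (op V))).1⟩
  else s

theorem Tangent.add_val (H : SchemeAxioms J R X) {s t : Tangent R x} {ψ : ctx (D2 R) V ⟶ ctx X V}
    (hψ : Extends ψ s.1 t.1) :
    (s.add t).1 = Functor.whiskerLeft (Over.forget V).op (diag R) ≫ ψ := by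
  have h : ∃ ψ, Extends ψ s.1 t.1 := ⟨ψ, hψ⟩
  have e : (s.add t).1 = Functor.whiskerLeft (Over.forget V).op (diag R) ≫ h.choose :=
    congrArg Subtype.val (dif_pos h)
  rw [e, h.choose_spec.unique H hψ]

theorem direction_eq (H : SchemeAxioms J R X) {P : ChartAt J R x g} {t : Tangent R x}
    {v : Fin P.n → R.obj (op W)} (h : HasDirection P t.1 v) : direction H P t = v :=
  (hasDirection_direction H P t).unique H h

theorem direction_zero (H : SchemeAxioms J R X) (P : ChartAt J R x g) :
    direction H P (Tangent.zero R x) = 0 :=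
  direction_eq H fun Z h ε => by
    have := P.isChartPoint.map h
    rw [← map_comp'] at this
    simp only [Pi.zero_apply, map_zero, mul_zero, add_zero]
    exact this

theorem direction_smul (H : SchemeAxioms J R X) (P : ChartAt J R x g) (r : R.obj (op V))
    (t : Tangent R x) : direction H P (t.smul r) = res R g r • direction H P t :=
  direction_eq H fun Z h ε => by
    have := hasDirection_direction H P t h
      (mkD1 (res R (h ≫ g) r * ε.1) (by rw [mul_pow, ε.2, mul_zero]))
    have e : appAt (t.smul r).1 (h ≫ g) ε = _ := appAt_scale_comp t.1 r (h ≫ g) ε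
    rw [e]
    convert this using 2 with j
    rw [Pi.smul_apply, smul_eq_mul, map_mul, ← res_comp]
    change _ = _ + res R (h ≫ g) r * ε.1 * _
    ring

theorem direction_add (H : SchemeAxioms J R X) (P : ChartAt J R x g) (s t : Tangent R x) :
    direction H P (s.add t) = direction H P s + direction H P t := by
  obtain ⟨ψ, hψ⟩ := (existsUnique_extends H s t).exists
  refine direction_eq H ?_
  rw [Tangent.add_val H hψ]
  exact (hψ.hasDirections H (hasDirection_direction H P s) (hasDirection_direction H P t)).diag

/-- The additive group of tangent vectors. -/
noncomputable abbrev Tangent.addCommGroup (H : SchemeAxioms J R X) (x : X.obj (op V)) :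
    AddCommGroup (Tangent R x) where
  add := Tangent.add
  add_assoc s t r := ext_direction H fun W g P => by
    change direction H P ((s.add t).add r) = direction H P (s.add (t.add r))
    simp only [direction_add, add_assoc]
  zero := Tangent.zero R x
  zero_add t := ext_direction H fun W g P => by
    change direction H P ((Tangent.zero R x).add t) = _
    rw [direction_add, direction_zero, zero_add]
  add_zero t := ext_direction H fun W g P => by
    change direction H P (t.add (Tangent.zero R x)) = _
    rw [direction_add, direction_zero, add_zero]
  nsmul := @nsmulRec _ ⟨Tangent.zero R x⟩ ⟨Tangent.add⟩
  neg t := t.smul (-1)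
  zsmul := @zsmulRec _ ⟨Tangent.zero R x⟩ ⟨Tangent.add⟩ ⟨fun t => t.smul (-1)⟩
    (@nsmulRec _ ⟨Tangent.zero R x⟩ ⟨Tangent.add⟩)
  neg_add_cancel t := ext_direction H fun W g P => by
    change direction H P ((t.smul (-1)).add t) = direction H P (Tangent.zero R x)
    rw [direction_add, direction_smul, direction_zero, map_neg, map_one, neg_one_smul,
      neg_add_cancel]
  add_comm s t := ext_direction H fun W g P => by
    change direction H P (s.add t) = direction H P (t.add s)
    rw [direction_add, direction_add, add_comm]

/-- The module of tangent vectors. -/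
noncomputable abbrev Tangent.module (H : SchemeAxioms J R X) (x : X.obj (op V)) :
    @Module (R.obj (op V)) (Tangent R x) _ (addCommGroup H x).toAddCommMonoid :=
  letI := addCommGroup H x
  { smul := Tangent.smul
    one_smul t := ext_direction H fun W g P => by
      change direction H P (t.smul 1) = _
      rw [direction_smul, map_one, one_smul]
    mul_smul r s t := ext_direction H fun W g P => by
      change direction H P (t.smul (r * s)) = direction H P ((t.smul s).smul r)
      simp only [direction_smul, map_mul, mul_smul]
    smul_zero r := ext_direction H fun W g P => by
      change direction H P ((Tangent.zero R x).smul r) = direction H P (Tangent.zero R x)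
      rw [direction_smul, direction_zero, smul_zero]
    smul_add r s t := ext_direction H fun W g P => by
      change direction H P ((s.add t).smul r) = direction H P ((s.smul r).add (t.smul r))
      simp only [direction_smul, direction_add, smul_add]
    add_smul r s t := ext_direction H fun W g P => by
      change direction H P (t.smul (r + s)) = direction H P ((t.smul r).add (t.smul s))
      simp only [direction_smul, direction_add, map_add, add_smul]
    zero_smul t := ext_direction H fun W g P => by
      change direction H P (t.smul 0) = direction H P (Tangent.zero R x)
      rw [direction_smul, direction_zero, map_zero, zero_smul] }

theorem Tangent.restrict_add (H : SchemeAxioms J R X) (s t : Tangent R x) (g : W ⟶ V)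
    (x' : X.obj (op W)) (hx : X.map g.op x = x') :
    (s.add t).restrict g x' hx = (s.restrict g x' hx).add (t.restrict g x' hx) := by
  obtain ⟨ψ, hψ⟩ := (existsUnique_extends H s t).exists
  refine Subtype.ext ?_
  rw [Tangent.add_val H (s := s.restrict g x' hx) (t := t.restrict g x' hx) (hψ.restrict g)]
  change resHom (s.add t).1 g = _
  rw [Tangent.add_val H hψ]
  rfl

theorem Tangent.restrict_smul (r : R.obj (op V)) (t : Tangent R x) (g : W ⟶ V)
    (x' : X.obj (op W)) (hx : X.map g.op x = x') :
    (t.smul r).restrict g x' hx = (t.restrict g x' hx).smul (res R g r) := by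
  refine Subtype.ext (appAt_ext fun Z h ε => ?_)
  change appAt t.1 (h ≫ g) (mkD1 (res R (h ≫ g) r * ε.1) _) =
    appAt t.1 (h ≫ g) (mkD1 (res R h (res R g r) * ε.1) _)
  congr 2
  rw [res_comp]

/-- The tangent space is the kernel of the Jacobian. -/
noncomputable def kernelEquiv (H : SchemeAxioms J R X) (P : ChartAt J R x (𝟙 V))
    (A : Matrix (Fin P.m) (Fin P.n) (R.obj (op V))) (hA : P.jacobian = A) :
    letI := Tangent.addCommGroup H x
    letI := Tangent.module H x
    Tangent R x ≃ₗ[R.obj (op V)] LinearMap.ker A.mulVecLin :=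
  letI := Tangent.addCommGroup H x
  letI := Tangent.module H x
  -- `A` is only propositionally equal to the Jacobian of `P`, so that the kernel can be that of an
  -- entrywise restricted matrix or of `jacobianAt f a`.
  have hker : ∀ t, direction H P t ∈ LinearMap.ker A.mulVecLin := fun t => by
    subst hA
    exact jacobian_mulVec_direction H P t
  let φ : Tangent R x →ₗ[R.obj (op V)] LinearMap.ker A.mulVecLin :=
    { toFun := fun t => ⟨direction H P t, hker t⟩
      map_add' := fun s t => Subtype.ext (direction_add H P s t)
      map_smul' := fun r t => by
        refine Subtype.ext ?_
        change direction H P (t.smul r) = r • direction H P t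
        rw [direction_smul, res_id] }
  LinearEquiv.ofBijective φ
    ⟨fun s t h => Tangent.ext_direction_id H P (congrArg Subtype.val h), fun v => by
      obtain ⟨t, ht⟩ := exists_tangent_of_jacobian P (v := v.1) (by subst hA; exact v.2)
      exact ⟨t, Subtype.ext (direction_eq H ht)⟩⟩

/-- Naturality of the isomorphism with the kernel: the restricted direction describes the restricted
tangent vector, and directions are unique. -/
theorem direction_restrict (H : SchemeAxioms J R X) (P : ChartAt J R x g) {Z Z' : C} {h : Z ⟶ W}
    {x₁ : X.obj (op Z)} (hx : X.map (𝟙 Z).op x₁ = X.map (h ≫ g).op x) {l : Z' ⟶ Z}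
    {x₂ : X.obj (op Z')} (hx₁ : X.map l.op x₁ = x₂) {h' : Z' ⟶ W} (e : h' = l ≫ h)
    (hx₂ : X.map (𝟙 Z').op x₂ = X.map (h' ≫ g).op x) (t : Tangent R x₁) (j : Fin P.n) :
    direction H (P.restrict h' (𝟙 Z') x₂ hx₂) (t.restrict l x₂ hx₁) j =
      res R l (direction H (P.restrict h (𝟙 Z) x₁ hx) t j) := by
  subst e
  suffices e : direction H (P.restrict (l ≫ h) (𝟙 Z') x₂ hx₂) (t.restrict l x₂ hx₁) =
      fun j => res R l (direction H (P.restrict h (𝟙 Z) x₁ hx) t j) from congrFun e j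
  refine direction_eq H fun Z'' m ε => ?_
  have key := hasDirection_direction H (P.restrict h (𝟙 Z) x₁ hx) t (m ≫ l) ε
  change IsChartPoint P.c ((m ≫ l) ≫ h ≫ P.k)
    (fun j => res R (m ≫ l) (res R h (P.a j)) + ε.1 * res R (m ≫ l) _)
    (appAt t.1 ((m ≫ l) ≫ 𝟙 Z) ε) at key
  change IsChartPoint P.c (m ≫ (l ≫ h) ≫ P.k)
    (fun j => res R m (res R (l ≫ h) (P.a j)) + ε.1 * res R m (res R l _))
    (appAt t.1 ((m ≫ 𝟙 Z') ≫ l) ε)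
  simpa only [Category.assoc, Category.comp_id, Category.id_comp, res_comp] using key

end Module

end SynAG

/-! ### The tangent space at a point of a scheme -/

theorem mainTheorem11 {C : Type u} [Category.{v} C] (J : GrothendieckTopology C)
    (R : Cᵒᵖ ⥤ CommRingCat.{w}) (hR : Presieve.IsSheaf J (R ⋙ forget CommRingCat))
    (hlocal : SynAG.Locality J R) (hduality : SynAG.Duality J R)
    (X : Cᵒᵖ ⥤ Type w) (hXsheaf : Presieve.IsSheaf J X) (hX : SynAG.IsScheme J R X)
    (U : C) (x : X.obj (op U)) :
    ∃ (_ : ∀ Y : (Over U)ᵒᵖ, AddCommGroup ((SynAG.tangentSpace R X x).obj Y))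
      (_ : ∀ Y : (Over U)ᵒᵖ,
        Module (R.obj (op Y.unop.left)) ((SynAG.tangentSpace R X x).obj Y)),
      -- the module structure: `(s + t)(ε) = ψ(ε, ε)` and `(r • t)(ε) = t(rε)`
      SynAG.IsModuleInContext R (SynAG.tangentSpace R X x) ∧
      (∀ (Y : (Over U)ᵒᵖ) (s t : (SynAG.tangentSpace R X x).obj Y),
        (∃! ψ : SynAG.ctx (SynAG.D2 R) Y.unop.left ⟶ SynAG.ctx X Y.unop.left,
          SynAG.Extends ψ s.1 t.1) ∧
        ∀ ψ : SynAG.ctx (SynAG.D2 R) Y.unop.left ⟶ SynAG.ctx X Y.unop.left,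
          SynAG.Extends ψ s.1 t.1 →
          (s + t).1 = Functor.whiskerLeft (Over.forget Y.unop.left).op (SynAG.diag R) ≫ ψ) ∧
      (∀ (Y : (Over U)ᵒᵖ) (r : R.obj (op Y.unop.left))
        (t : (SynAG.tangentSpace R X x).obj Y), (r • t).1 = SynAG.scale R r ≫ t.1) ∧
      -- the tangent space is finitely copresented
      SynAG.IsFinitelyCopresented J R (SynAG.tangentSpace R X x) ∧
      -- in an affine open chart through `x` it is the kernel of the Jacobian
      (∀ (Y : Over U) (n m : ℕ) (f : Fin m → MvPolynomial (Fin n) (R.obj (op Y.left)))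
        (c : SynAG.spec R f ⟶ SynAG.ctx X Y.left), SynAG.IsAffineOpenChart J R c →
        ∀ a : (SynAG.spec R f).obj (op (Over.mk (𝟙 Y.left))),
          c.app (op (Over.mk (𝟙 Y.left))) a = X.map Y.hom.op x →
          ∃ e : (SynAG.tangentSpace R X x).obj (op Y) ≃ₗ[R.obj (op Y.left)]
              LinearMap.ker (SynAG.jacobianAt f a.1).mulVecLin,
            ∀ (t : (SynAG.tangentSpace R X x).obj (op Y)) (Z : Over Y.left)
              (ε : (SynAG.D1 R).obj (op Z.left)),
              ∃ b : (SynAG.spec R f).obj (op Z),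
                (∀ j, b.1 j = SynAG.res R Z.hom (a.1 j) + ε.1 * SynAG.res R Z.hom ((e t).1 j)) ∧
                t.1.app (op Z) ε = c.app (op Z) b) := by
  have H : SynAG.SchemeAxioms J R X := ⟨hR, hlocal, hduality, hXsheaf, hX⟩
  -- The elements of `tangentSpace R X x` at `Y` are by definition the tangent vectors at the
  -- restriction of `x` to `Y`.
  refine ⟨fun Y => SynAG.Tangent.addCommGroup H (X.map Y.unop.hom.op x),
    fun Y => SynAG.Tangent.module H (X.map Y.unop.hom.op x), ?_, ?_, ?_, ?_, ?_⟩
  · intro Y Y' φ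
    have hx : X.map φ.unop.left.op (X.map Y.unop.hom.op x) = X.map Y'.unop.hom.op x := by
      rw [← SynAG.map_comp', Over.w]
    exact ⟨fun s t => SynAG.Tangent.restrict_add H s t φ.unop.left _ hx,
      fun r t => SynAG.Tangent.restrict_smul r t φ.unop.left _ hx⟩
  · intro Y s t
    exact ⟨SynAG.existsUnique_extends H s t, fun ψ hψ => SynAG.Tangent.add_val H hψ⟩
  · intro Y r t
    rfl
  · obtain ⟨S, hS, h⟩ := H.locally_chartAt x
    refine ⟨S, hS, fun W hW => ?_⟩
    obtain ⟨P⟩ := h W.hom hW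
    have hx : ∀ (Y : (Over U)ᵒᵖ) (h : Y.unop ⟶ W),
        X.map (𝟙 Y.unop.left).op (X.map Y.unop.hom.op x) = X.map (h.left ≫ W.hom).op x :=
      fun Y h => by rw [SynAG.map_id', Over.w]
    -- One chart over `W` serves all later stages; its restrictions have the restricted Jacobian.
    refine ⟨P.n, P.m, P.jacobian, fun Y h => SynAG.kernelEquiv H
      (P.restrict h.left (𝟙 Y.unop.left) (X.map Y.unop.hom.op x) (hx Y h)) _
      (SynAG.chartJacobian_map P.a h.left).symm, fun Y Y' φ h t j => ?_⟩
    exact SynAG.direction_restrict H P (hx Y h) (by rw [← SynAG.map_comp', Over.w])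
      (Over.comp_left _ _ _ _ _) (hx Y' (φ.unop ≫ h)) t j
  · intro Y n m f c hc a ha
    let P : SynAG.ChartAt J R (X.map Y.hom.op x) (𝟙 Y.left) :=
      ⟨Y.left, 𝟙 Y.left, n, m, f, c, hc, a.1, a.2, by rw [SynAG.map_id']; exact ha⟩
    have hP : P.jacobian = SynAG.jacobianAt f a.1 := by
      have e : SynAG.res R (𝟙 Y.left) = RingHom.id _ := RingHom.ext SynAG.res_id
      change SynAG.jacobianAt (fun i => MvPolynomial.map (SynAG.res R (𝟙 Y.left)) (f i)) a.1 = _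
      simp only [e, MvPolynomial.map_id]
    refine ⟨SynAG.kernelEquiv H P _ hP, fun t Z ε => ?_⟩
    have key := SynAG.hasDirection_direction H P t Z.hom ε
    change SynAG.IsChartPoint c (Z.hom ≫ 𝟙 Y.left) _
      (SynAG.appAt t.1 (Z.hom ≫ 𝟙 Y.left) ε) at key
    rw [Category.comp_id] at key
    obtain ⟨hb, hy⟩ := key
    exact ⟨⟨_, hb⟩, fun j => rfl, hy.symm⟩
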